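/- Let $T>0$, $y^0,\delta\in\mathbb R$, $\rho>0$, and let $W$ be a one-dimensional Brownian motion relative to a filtration $\{\mathcal F_t\}$ on a probability space $(\Omega,\mathcal F,\mathrm P)$ (for instance its natural filtration). Let $b(t,y,u)=b_y'(t)y+b_u'(t)u+m(t)$, where $b_y',b_u'$ are measurable and bounded on $[0,T]$, $m\in L^1(0,T)$, and $b_u'$ is not almost everywhere zero on $[0,T]$. Let $\sigma:\mathbb R^2\to\mathbb R$ be $C^1$ with bounded partial derivatives and let $h,j,k:\mathbb R\to\mathbb R$ be $C^1$ with derivatives of at most linear growth. For $u\in L^2([0,T];\mathbb R)$ let $y^u$ denote the adapted solution, square integrable on $[0,T]\times\Omega$, of $$dy_t^u=b(t,y_t^u,u(t))\,dt+\sigma(y_t^u,u(t))\,dW_t,\qquad y_0^u=y^0,$$ and set $J(u)=\mathbb E\big[\int_0^T (h(y_t^u)+j(u(t)))\,dt+k(y_T^u)\big]$, $G(u)=\int_0^T\mathbb E[y_t^u]\,dt-\delta$ and $U(\delta)=\{u\in L^2([0,T];\mathbb R): G(u)\le 0\}$. Then the state equation has such a solution for every $u\in L^2([0,T];\mathbb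 R)$, and the following holds. The linear ODEs (in integrated form) $$-d\psi=(1+b_y'\psi)\,dt,\ \psi(T)=0,\qquad d\varphi=\big(b_y'\varphi+(b_u')^2\psi\big)\,dt,\ \varphi(0)=0$$ have unique continuous solutions $\psi,\varphi$ on $[0,T]$, and $\int_0^T\varphi\,dt>0$. For $w\in L^2([0,T];\mathbb R)$ put $$\mu(w)=\frac{\max\{\mathbb E[\int_0^T y_t^{w}\,dt]-\delta,\,0\}}{\rho\int_0^T\varphi(t)\,dt}\ \ge 0,\qquad \mathbb P w=w-\rho\,\mu(w)\,\psi\, b_u'.$$ Then, for every $w$, $\mathbb Pw\in U(\delta)$, $(\mathbb Pw-w,\,v-\mathbb Pw)\ge 0$ for all $v\in U(\delta)$, and $\mathbb Pw$ is the unique point of $U(\delta)$ nearest to $w$ in $L^2([0,T];\mathbb R)$. Consequently, for the gradient projection iteration in which $u^{i+1}$ is the projection of $u^{i+1/2}:=u^i-\rho J'(u^i)$ onto $U(\delta)$, where $J$ is Fréchet differentiable at $u^i\in L^2([0,T];\mathbb R)$ with gradient $J'(u^i)$, the multiplier $\mu^i:=\mu(u^{i+1/2})$ satisfies $\mu^i\ge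 0$ and $u^{i+1}=u^{i+1/2}-\rho\,\mu^i\,\psi\, b_u'$, the next state satisfies $\mathbb E\big[\int_0^T y_t^{u^{i+1}}dt\big]\le\delta$, and $(u^{i+1}-u^{i+1/2},\,v-u^{i+1})\ge0$ for all $v\in U(\delta)$. -/

import Mathlib

open MeasureTheory ProbabilityTheory Filter Topology
open scoped NNReal ENNReal

/-- `W` is a real Brownian motion relative to the filtration `𝓕`: it is a Brownian motion, it is
adapted, and its increments after time `s` are independent of `𝓕 s`. The natural filtration of
`W` and its completion by null sets are instances of such an `𝓕`. -/
structure IsBrownianMotionFor {Ω : Type*} {mΩ : MeasurableSpace Ω} (P : Measure Ω)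
    (𝓕 : Filtration ℝ≥0 mΩ) (W : ℝ≥0 → Ω → ℝ) : Prop where
  brownian : IsBrownianReal W P
  adapted : StronglyAdapted 𝓕 W
  indep : ∀ s t : ℝ≥0, s ≤ t →
    Indep (MeasurableSpace.comap (fun ω => W t ω - W s ω) inferInstance) (𝓕 s) P

/-- Lebesgue measure on the time interval `[0, T]`. -/
noncomputable abbrev timeMeasure (T : ℝ) : Measure ℝ := volume.restrict (Set.Icc 0 T)

/-- The space of (deterministic) controls `L²([0, T]; ℝ)`. -/
abbrev Control (T : ℝ) : Type := Lp ℝ 2 (timeMeasure T)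

/-- The space `L²_𝓕([0, T] × Ω; ℝ)` of adapted square-integrable processes. -/
structure MemL2Adapted {Ω : Type*} {mΩ : MeasurableSpace Ω} (P : Measure Ω)
    (𝓕 : Filtration ℝ≥0 mΩ) (T : ℝ) (y : ℝ → Ω → ℝ) : Prop where
  adapted : ∀ t : ℝ≥0, (t : ℝ) ≤ T → StronglyMeasurable[𝓕 t] (y t)
  memLp : MemLp (fun p : ℝ × Ω => y p.1 p.2) 2 ((timeMeasure T).prod P)

/-- A simple process `∑ k < n, ξ k · 1_(τ k, τ (k+1)]` with `ξ k` square-integrable and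
`𝓕 (τ k)`-measurable. -/
structure SimpleProcess {Ω : Type*} {mΩ : MeasurableSpace Ω} (P : Measure Ω)
    (𝓕 : Filtration ℝ≥0 mΩ) where
  n : ℕ
  τ : ℕ → ℝ≥0
  ξ : ℕ → Ω → ℝ
  mono : Monotone τ
  meas : ∀ k, StronglyMeasurable[𝓕 (τ k)] (ξ k)
  memLp : ∀ k, MemLp (ξ k) 2 P

namespace SimpleProcess

variable {Ω : Type*} {mΩ : MeasurableSpace Ω} {P : Measure Ω} {𝓕 : Filtration ℝ≥0 mΩ}

/-- The value of a simple process at time `t`. -/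
noncomputable def eval (S : SimpleProcess P 𝓕) (t : ℝ) (ω : Ω) : ℝ :=
  ∑ k ∈ Finset.range S.n,
    (Set.Ioc (S.τ k : ℝ) (S.τ (k + 1) : ℝ)).indicator (fun _ => S.ξ k ω) t

/-- The elementary stochastic integral `∫_0^t S dW`. -/
noncomputable def integral (S : SimpleProcess P 𝓕) (W : ℝ≥0 → Ω → ℝ) (t : ℝ≥0) (ω : Ω) : ℝ :=
  ∑ k ∈ Finset.range S.n,
    S.ξ k ω * (W (min (S.τ (k + 1)) t) ω - W (min (S.τ k) t) ω)

end SimpleProcess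

/-- `I t = ∫_0^t H dW` for `t ∈ [0, T]`, in the sense of Itô: `H` is the limit in
`L²([0, T] × Ω)` of simple processes whose elementary integrals up to time `t` converge to `I t`
in `L²(Ω)`, for every `t ∈ [0, T]`. -/
structure IsItoIntegral {Ω : Type*} {mΩ : MeasurableSpace Ω} (P : Measure Ω)
    (𝓕 : Filtration ℝ≥0 mΩ) (W : ℝ≥0 → Ω → ℝ) (T : ℝ)
    (H : ℝ → Ω → ℝ) (I : ℝ≥0 → Ω → ℝ) : Prop where
  integrand_memLp : MemLp (fun p : ℝ × Ω => H p.1 p.2) 2 ((timeMeasure T).prod P)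
  integral_memLp : ∀ t : ℝ≥0, (t : ℝ) ≤ T → MemLp (I t) 2 P
  approx : ∃ S : ℕ → SimpleProcess P 𝓕,
    Tendsto (fun l => eLpNorm (fun p : ℝ × Ω => (S l).eval p.1 p.2 - H p.1 p.2) 2
      ((timeMeasure T).prod P)) atTop (𝓝 0) ∧
    ∀ t : ℝ≥0, (t : ℝ) ≤ T →
      Tendsto (fun l => eLpNorm (fun ω => (S l).integral W t ω - I t ω) 2 P) atTop (𝓝 0)

/-- The data of the one-dimensional stochastic optimal control problem with linear drift
`b(t, y, u) = by t * y + bu t * u + m t`, diffusion coefficient `σ(y, u)`, initial state `y₀`,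
running costs `h(y)` and `j(u)`, terminal cost `k(y_T)`, and constraint level `δ`. -/
structure LinearSOCP where
  T : ℝ
  y₀ : ℝ
  δ : ℝ
  by' : ℝ → ℝ
  bu' : ℝ → ℝ
  m : ℝ → ℝ
  σ : ℝ → ℝ → ℝ
  h : ℝ → ℝ
  j : ℝ → ℝ
  k : ℝ → ℝ

/-- A `C¹` function whose derivative has at most linear growth. -/
def IsC1LinearGrowthDeriv (f : ℝ → ℝ) : Prop :=
  ContDiff ℝ 1 f ∧ ∃ C : ℝ, ∀ x, |deriv f x| ≤ C * (1 + |x|)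

namespace LinearSOCP

/-- The drift coefficient. -/
def b (S : LinearSOCP) (t y u : ℝ) : ℝ := S.by' t * y + S.bu' t * u + S.m t

/-- The assumptions on the coefficients. -/
structure Assumptions (S : LinearSOCP) : Prop where
  T_pos : 0 < S.T
  by_meas : AEStronglyMeasurable S.by' (timeMeasure S.T)
  bu_meas : AEStronglyMeasurable S.bu' (timeMeasure S.T)
  b_bound : ∃ C : ℝ, ∀ t ∈ Set.Icc 0 S.T, |S.by' t| + |S.bu' t| ≤ C
  m_integrable : IntegrableOn S.m (Set.Icc 0 S.T)
  σ_contDiff : ContDiff ℝ 1 (fun p : ℝ × ℝ => S.σ p.1 p.2)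
  σ_bound : ∃ C : ℝ, ∀ y u : ℝ,
    |deriv (fun y' => S.σ y' u) y| + |deriv (fun u' => S.σ y u') u| ≤ C
  h_growth : IsC1LinearGrowthDeriv S.h
  j_growth : IsC1LinearGrowthDeriv S.j
  k_growth : IsC1LinearGrowthDeriv S.k

section Stochastic

variable {Ω : Type*} {mΩ : MeasurableSpace Ω}

/-- `y` solves `dy = b(t, y, u) dt + σ(y, u) dW` on `[0, T]`, `y_0 = y₀`, and belongs to
`L²_𝓕([0, T] × Ω; ℝ)`. -/
structure IsState (S : LinearSOCP) (P : Measure Ω) (𝓕 : Filtration ℝ≥0 mΩ) (W : ℝ≥0 → Ω → ℝ)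
    (u : Control S.T) (y : ℝ → Ω → ℝ) : Prop where
  memL2 : MemL2Adapted P 𝓕 S.T y
  equation : ∃ I : ℝ≥0 → Ω → ℝ,
    IsItoIntegral P 𝓕 W S.T (fun t ω => S.σ (y t ω) (u t)) I ∧
    ∀ t : ℝ≥0, (t : ℝ) ≤ S.T → ∀ᵐ ω ∂P,
      y t ω = S.y₀ + (∫ s in (0 : ℝ)..t, S.b s (y s ω) (u s)) + I t ω

open Classical in
/-- The state process `y^u` of the control `u`: a chosen solution of the state equation. -/
noncomputable def state (S : LinearSOCP) (P : Measure Ω) (𝓕 : Filtration ℝ≥0 mΩ)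
    (W : ℝ≥0 → Ω → ℝ) (u : Control S.T) : ℝ → Ω → ℝ :=
  if h : ∃ y, S.IsState P 𝓕 W u y then h.choose else 0

/-- The objective `J(u) = E[∫_0^T (h(y_t^u) + j(u(t))) dt + k(y_T^u)]`. -/
noncomputable def J (S : LinearSOCP) (P : Measure Ω) (𝓕 : Filtration ℝ≥0 mΩ)
    (W : ℝ≥0 → Ω → ℝ) (u : Control S.T) : ℝ :=
  ∫ ω, ((∫ t in (0 : ℝ)..S.T, (S.h (S.state P 𝓕 W u t ω) + S.j (u t)))
    + S.k (S.state P 𝓕 W u S.T ω)) ∂P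

/-- The constraint functional `G(u) = ∫_0^T E[y_t^u] dt - δ`. -/
noncomputable def G (S : LinearSOCP) (P : Measure Ω) (𝓕 : Filtration ℝ≥0 mΩ)
    (W : ℝ≥0 → Ω → ℝ) (u : Control S.T) : ℝ :=
  (∫ t in (0 : ℝ)..S.T, ∫ ω, S.state P 𝓕 W u t ω ∂P) - S.δ

/-- The feasible set `U(δ)`. -/
def feasible (S : LinearSOCP) (P : Measure Ω) (𝓕 : Filtration ℝ≥0 mΩ)
    (W : ℝ≥0 → Ω → ℝ) : Set (Control S.T) :=
  {u | S.G P 𝓕 W u ≤ 0}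

/-- `E[∫_0^T y_t^u dt]`. -/
noncomputable def expectedIntegral (S : LinearSOCP) (P : Measure Ω) (𝓕 : Filtration ℝ≥0 mΩ)
    (W : ℝ≥0 → Ω → ℝ) (u : Control S.T) : ℝ :=
  ∫ ω, (∫ t in (0 : ℝ)..S.T, S.state P 𝓕 W u t ω) ∂P

/-- The multiplier `max{E[∫_0^T y_t^w dt] - δ, 0} / (ρ ∫_0^T φ(t) dt)`. -/
noncomputable def multiplier (S : LinearSOCP) (P : Measure Ω) (𝓕 : Filtration ℝ≥0 mΩ)
    (W : ℝ≥0 → Ω → ℝ) (ρ : ℝ) (φ : ℝ → ℝ) (w : Control S.T) : ℝ :=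
  max (S.expectedIntegral P 𝓕 W w - S.δ) 0 / (ρ * ∫ t in (0 : ℝ)..S.T, φ t)

/-- The gradient step `u - ρ J'(u)`. -/
noncomputable def gradStep (S : LinearSOCP) (P : Measure Ω) (𝓕 : Filtration ℝ≥0 mΩ)
    (W : ℝ≥0 → Ω → ℝ) (ρ : ℝ) (u : Control S.T) : Control S.T :=
  u - ρ • gradient (S.J P 𝓕 W) u

end Stochastic

/-- `-dψ = (1 + ψ b_y') dt` on `[0, T]`, `ψ(T) = 0`, in integrated form. -/
def IsPsi (S : LinearSOCP) (ψ : ℝ → ℝ) : Prop :=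
  ContinuousOn ψ (Set.Icc 0 S.T) ∧
    ∀ t ∈ Set.Icc 0 S.T, ψ t = ∫ s in t..S.T, (1 + ψ s * S.by' s)

/-- `dφ = (b_y' φ + (b_u')² ψ) dt` on `[0, T]`, `φ(0) = 0`, in integrated form. -/
def IsPhi (S : LinearSOCP) (ψ φ : ℝ → ℝ) : Prop :=
  ContinuousOn φ (Set.Icc 0 S.T) ∧
    ∀ t ∈ Set.Icc 0 S.T, φ t = ∫ s in (0 : ℝ)..t, (S.by' s * φ s + S.bu' s ^ 2 * ψ s)

end LinearSOCP

/-- `p` is a point of `Q` nearest to `w`. -/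
def IsProjection {E : Type*} [NormedAddCommGroup E] (Q : Set E) (w p : E) : Prop :=
  p ∈ Q ∧ ∀ z ∈ Q, ‖w - p‖ ≤ ‖w - z‖

/-! Itô integrals have mean zero, so for any solution `y` of the state equation the mean `z = E y`
solves the scalar linear ODE `z' = b_y' z + b_u' u + m`. Pairing it with the adjoint `ψ` gives `∫ z
= ψ(0) y₀ + ∫ ψ (b_u' u + m)` (`integral_eq_of_adjoint`, `IsState.mean_eq`, `G_eq`). Hence `G` is an
affine functional on `L²` with gradient `g = ψ b_u'` (`G_sub_eq_inner`), `U(δ)` is a half-space, and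
the nearest point to `w` is `w - (max (G w) 0 / ‖g‖²) g` (`halfSpace_projection`). The same pairing
applied to `φ` gives `∫ φ = ‖g‖²` (`IsPhi.integral_eq`), which identifies the multiplier; `g ≠ 0`
because `ψ > 0` on `[0, T)`. Only means enter `G`, so uniqueness of the state is not needed.

The longer part is existence of a state. It is a Picard fixed point in `C([0, T], L²(Ω))`,
restricted to adapted curves, where the weight `exp (r t)` with large `r` makes the iteration
contract (`exists_isFixedPt_of_exp_bound`, `IsPicardStep.norm_sub_le`). The noise estimate is the
Itô isometry, proved first for elementary sums by comparing Gram matrices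
(`eLpNorm_sum_elementary`). To pass between curves and processes, each adapted curve is represented
by a jointly measurable adapted process (`exists_isRealization`), along which `σ(y, u)` is a limit
of simple processes (`IsRealization.exists_simpleProcess_le`). -/

theorem AbsolutelyContinuousOnInterval.comp_lipschitzOn {f g : ℝ → ℝ} {a b : ℝ} {K : ℝ≥0}
    {s : Set ℝ} (hg : LipschitzOnWith K g s) (hf : AbsolutelyContinuousOnInterval f a b)
    (hs : Set.MapsTo f (Set.uIcc a b) s) : AbsolutelyContinuousOnInterval (fun t => g (f t)) a b := by
  have h0 : Tendsto (fun E : ℕ × (ℕ → ℝ × ℝ) =>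
      (K : ℝ) * ∑ i ∈ Finset.range E.1, dist (f (E.2 i).1) (f (E.2 i).2))
      (AbsolutelyContinuousOnInterval.totalLengthFilter ⊓
        𝓟 (AbsolutelyContinuousOnInterval.disjWithin a b)) (𝓝 0) := by
    simpa using Tendsto.const_mul (K : ℝ) hf
  refine squeeze_zero' (.of_forall fun E => Finset.sum_nonneg fun _ _ => dist_nonneg) ?_ h0
  have : ∀ᶠ E : ℕ × (ℕ → ℝ × ℝ) in AbsolutelyContinuousOnInterval.totalLengthFilter ⊓
        𝓟 (AbsolutelyContinuousOnInterval.disjWithin a b),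
      E ∈ AbsolutelyContinuousOnInterval.disjWithin a b :=
    eventually_inf_principal.mpr (by simp)
  filter_upwards [this] with E hE
  rw [Finset.mul_sum]
  refine Finset.sum_le_sum fun i hi => ?_
  have := hE.1 i hi
  exact hg.dist_le_mul _ (hs this.1) _ (hs this.2)

theorem lipschitzOnWith_exp_Iic (M : ℝ) :
    LipschitzOnWith (Real.exp M).toNNReal Real.exp (Set.Iic M) := by
  refine (convex_Iic M).lipschitzOnWith_of_nnnorm_deriv_le (fun x _ => by fun_prop) fun x hx => ?_
  rw [Real.deriv_exp, Real.nnnorm_of_nonneg (Real.exp_pos x).le, ← Real.toNNReal_of_nonneg]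
  exact Real.toNNReal_le_toNNReal (Real.exp_le_exp.2 hx)

theorem AbsolutelyContinuousOnInterval.exp {f : ℝ → ℝ} {a b : ℝ}
    (hf : AbsolutelyContinuousOnInterval f a b) :
    AbsolutelyContinuousOnInterval (fun t => Real.exp (f t)) a b := by
  have hb : ∃ M : ℝ, Set.MapsTo f (Set.uIcc a b) (Set.Iic M) := by
    obtain ⟨M, hM⟩ := hf.exists_bound
    exact ⟨M, fun t ht => (le_abs_self (f t)).trans (hM t ht)⟩
  have := hb.choose_spec
  exact AbsolutelyContinuousOnInterval.comp_lipschitzOn (lipschitzOnWith_exp_Iic _) hf this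

/-! ### Scalar linear ODEs with integrable coefficients -/

section LinearODE

variable {T : ℝ} {a : ℝ → ℝ}

theorem ae_hasDerivAt_primitive {f : ℝ → ℝ} {c : ℝ} (hf : IntervalIntegrable f volume 0 T)
    (hc : c ∈ Set.uIcc 0 T) :
    ∀ᵐ x, x ∈ Set.uIcc 0 T → HasDerivAt (fun t => ∫ s in c..t, f s) (f x) x := by
  filter_upwards [hf.ae_hasDerivAt_integral] with x hx hxm using hx hxm c hc

theorem AbsolutelyContinuousOnInterval.eq_integral {f f' : ℝ → ℝ}
    (hf : AbsolutelyContinuousOnInterval f 0 T)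
    (hd : ∀ᵐ x, x ∈ Set.uIcc 0 T → HasDerivAt f (f' x) x) {s t : ℝ} (hs : s ∈ Set.uIcc 0 T)
    (ht : t ∈ Set.uIcc 0 T) : ∫ x in s..t, f' x = f t - f s := by
  have hst : Set.uIcc s t ⊆ Set.uIcc 0 T := Set.uIcc_subset_uIcc hs ht
  rw [← (hf.mono hst).integral_deriv_eq_sub]
  refine intervalIntegral.integral_congr_ae ?_
  filter_upwards [hd] with x hx hxm
  exact ((hx (hst (Set.uIoc_subset_uIcc hxm))).deriv).symm

/-- The product of `d` with the integrating factor `exp (-∫ a)` is absolutely continuous with zero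
derivative a.e., hence constant. The base point `c` is free because `ψ` is pinned at `T` and `φ` at
`0`. -/
theorem AbsolutelyContinuousOnInterval.eq_zero_of_linear {d : ℝ → ℝ} {c : ℝ}
    (ha : IntervalIntegrable a volume 0 T) (hd : AbsolutelyContinuousOnInterval d 0 T)
    (hd' : ∀ᵐ x, x ∈ Set.uIcc 0 T → HasDerivAt d (a x * d x) x) (hc : c ∈ Set.uIcc 0 T)
    (h0 : d c = 0) : ∀ x ∈ Set.uIcc 0 T, d x = 0 := by
  have hA := (ha.absolutelyContinuousOnInterval_intervalIntegral
    (c := 0) Set.left_mem_uIcc).fun_neg.exp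
  obtain ⟨C, hC⟩ := (hd.fun_mul hA).const_of_ae_hasDerivAt_zero (by
    filter_upwards [hd', ae_hasDerivAt_primitive ha Set.left_mem_uIcc] with x h1 h2 hx
    convert! (h1 hx).mul ((h2 hx).fun_neg.exp) using 1
    ring)
  intro x hx
  have h1 := hC x hx
  rw [← hC c hc, h0, zero_mul] at h1
  exact (mul_eq_zero.1 h1).resolve_right (Real.exp_pos _).ne'

/-- The terms in `a` cancel in `(ψ z)' = ψ f - z`; integrate over `[0, T]` and use `ψ T = 0`. It is
applied to the mean of the state and again to `φ`. -/
theorem integral_eq_of_adjoint {ψ z f : ℝ → ℝ} {z₀ : ℝ} (hT : 0 ≤ T)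
    (ha : IntervalIntegrable a volume 0 T) (hf : IntervalIntegrable f volume 0 T)
    (hψc : ContinuousOn ψ (Set.Icc 0 T))
    (hψ : ∀ t ∈ Set.Icc 0 T, ψ t = ∫ s in t..T, (1 + ψ s * a s))
    (hzc : ContinuousOn z (Set.Icc 0 T))
    (hz : ∀ t ∈ Set.Icc 0 T, z t = z₀ + ∫ s in (0 : ℝ)..t, (a s * z s + f s)) :
    ∫ t in (0 : ℝ)..T, z t = ψ 0 * z₀ + ∫ t in (0 : ℝ)..T, ψ t * f t := by
  rw [← Set.uIcc_of_le hT] at *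
  have i1 : IntervalIntegrable (fun s => 1 + ψ s * a s) volume 0 T :=
    intervalIntegrable_const.add (ha.continuousOn_mul hψc)
  have i2 : IntervalIntegrable (fun s => a s * z s + f s) volume 0 T :=
    (ha.mul_continuousOn hzc).add hf
  have iψ : IntervalIntegrable (fun s => ψ s * f s) volume 0 T := hf.continuousOn_mul hψc
  have iz : IntervalIntegrable z volume 0 T := hzc.intervalIntegrable
  -- Moving the variable to the upper endpoint makes `ψ` a primitive based at `T`, to which absolute
  -- continuity and a.e. differentiation apply.
  have e1 : ∀ t ∈ Set.uIcc 0 T, ψ t = -∫ s in T..t, (1 + ψ s * a s) := fun t ht => by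
    rw [hψ t ht, intervalIntegral.integral_symm]
  have A1 := (i1.absolutelyContinuousOnInterval_intervalIntegral
    (c := T) Set.right_mem_uIcc).fun_neg
  have A2 : AbsolutelyContinuousOnInterval
      (fun t => z₀ + ∫ s in (0 : ℝ)..t, (a s * z s + f s)) 0 T :=
    ((LipschitzWith.const z₀).lipschitzOnWith.absolutelyContinuousOnInterval).fun_add
    (i2.absolutelyContinuousOnInterval_intervalIntegral (c := 0) Set.left_mem_uIcc)
  have key := A1.integral_deriv_mul_eq_sub A2
  rw [← e1 T Set.right_mem_uIcc, ← e1 0 Set.left_mem_uIcc, hψ T Set.right_mem_uIcc] at key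
  simp only [intervalIntegral.integral_same, zero_mul, add_zero, zero_sub] at key
  have : ∫ x in (0 : ℝ)..T, (ψ x * f x - z x) = -(ψ 0 * z₀) := by
    rw [← key]
    refine intervalIntegral.integral_congr_ae ?_
    filter_upwards [ae_hasDerivAt_primitive i1 Set.right_mem_uIcc,
      ae_hasDerivAt_primitive i2 Set.left_mem_uIcc] with x h1 h2 hx
    have hx := Set.uIoc_subset_uIcc hx
    rw [(h1 hx).fun_neg.deriv, ((h2 hx).const_add z₀).deriv, ← e1 x hx, ← hz x hx]
    ring
  rw [intervalIntegral.integral_sub iψ iz] at this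
  linarith

/-- Variation of constants: with `A t = ∫ a` over `[0, t]`, take `z = exp A * ∫ exp (-A) g`. -/
theorem exists_linear_ode_solution {g : ℝ → ℝ} (ha : IntervalIntegrable a volume 0 T)
    (hg : IntervalIntegrable g volume 0 T) :
    ∃ z : ℝ → ℝ, ContinuousOn z (Set.uIcc 0 T) ∧
      ∀ t ∈ Set.uIcc 0 T, z t = ∫ s in (0 : ℝ)..t, (a s * z s + g s) := by
  have hA := ha.absolutelyContinuousOnInterval_intervalIntegral (c := 0) Set.left_mem_uIcc
  have hG := hg.continuousOn_mul hA.fun_neg.exp.continuousOn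
  have hz := hA.exp.fun_mul
    (hG.absolutelyContinuousOnInterval_intervalIntegral (c := 0) Set.left_mem_uIcc)
  refine ⟨_, hz.continuousOn, fun t ht => ?_⟩
  have h := hz.eq_integral (f' := fun s => a s * (Real.exp (∫ v in (0 : ℝ)..s, a v) *
    ∫ v in (0 : ℝ)..s, Real.exp (-∫ v in (0 : ℝ)..v, a v) * g v) + g s) ?_ Set.left_mem_uIcc ht
  · simp only [intervalIntegral.integral_same, mul_zero, sub_zero] at h
    exact h.symm
  filter_upwards [ae_hasDerivAt_primitive ha Set.left_mem_uIcc,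
    ae_hasDerivAt_primitive hG Set.left_mem_uIcc] with x h1 h2 hx
  convert! (h1 hx).exp.mul (h2 hx) using 1
  rw [← mul_assoc (Real.exp _) (Real.exp _), ← Real.exp_add]
  simp only [add_neg_cancel, Real.exp_zero]
  ring

/-- With `A t = ∫ a` over `[0, t]`, the solution is `exp (-A t) * ∫ exp A` over `[t, T]`, whose sign
is visible. -/
theorem exists_adjoint_solution (hT : 0 ≤ T) (ha : IntervalIntegrable a volume 0 T) :
    ∃ ψ : ℝ → ℝ, ContinuousOn ψ (Set.Icc 0 T) ∧
      (∀ t ∈ Set.Icc 0 T, ψ t = ∫ s in t..T, (1 + ψ s * a s)) ∧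
      ∀ t ∈ Set.Ico 0 T, 0 < ψ t := by
  have hA := ha.absolutelyContinuousOnInterval_intervalIntegral (c := 0) Set.left_mem_uIcc
  have hG : IntervalIntegrable (fun t => Real.exp (∫ s in (0 : ℝ)..t, a s)) volume 0 T :=
    hA.exp.continuousOn.intervalIntegrable
  have hz := hA.fun_neg.exp.fun_mul
    (hG.absolutelyContinuousOnInterval_intervalIntegral (c := T) Set.right_mem_uIcc).fun_neg
  have hc := hz.continuousOn
  rw [Set.uIcc_of_le hT] at hc
  refine ⟨_, hc, fun t ht => ?_, fun t ht => ?_⟩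
  · rw [← Set.uIcc_of_le hT] at ht
    have h := hz.eq_integral (f' := fun x => -(1 + Real.exp (-∫ s in (0 : ℝ)..x, a s) *
      (-∫ s in T..x, Real.exp (∫ s in (0 : ℝ)..s, a s)) * a x)) ?_ ht Set.right_mem_uIcc
    · rw [intervalIntegral.integral_neg, intervalIntegral.integral_same] at h
      linarith
    · filter_upwards [ae_hasDerivAt_primitive ha Set.left_mem_uIcc,
        ae_hasDerivAt_primitive hG Set.right_mem_uIcc] with x h1 h2 hx
      convert! (h1 hx).fun_neg.exp.mul (h2 hx).fun_neg using 1
      have : Real.exp (-∫ s in (0 : ℝ)..x, a s) * Real.exp (∫ s in (0 : ℝ)..x, a s) = 1 := by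
        rw [← Real.exp_add]; simp
      linear_combination this
  · refine mul_pos (Real.exp_pos _) ?_
    rw [← intervalIntegral.integral_symm]
    refine intervalIntegral.intervalIntegral_pos_of_pos_on
      (hG.mono_set (Set.uIcc_subset_uIcc ?_ Set.right_mem_uIcc)) (fun _ _ => Real.exp_pos _) ht.2
    rw [Set.uIcc_of_le hT]
    exact ⟨ht.1, ht.2.le⟩

theorem adjoint_solution_unique {ψ₁ ψ₂ : ℝ → ℝ} (hT : 0 ≤ T)
    (ha : IntervalIntegrable a volume 0 T)
    (hc₁ : ContinuousOn ψ₁ (Set.Icc 0 T)) (hc₂ : ContinuousOn ψ₂ (Set.Icc 0 T))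
    (h₁ : ∀ t ∈ Set.Icc 0 T, ψ₁ t = ∫ s in t..T, (1 + ψ₁ s * a s))
    (h₂ : ∀ t ∈ Set.Icc 0 T, ψ₂ t = ∫ s in t..T, (1 + ψ₂ s * a s)) :
    Set.EqOn ψ₁ ψ₂ (Set.Icc 0 T) := by
  rw [← Set.uIcc_of_le hT] at *
  have i₁ : IntervalIntegrable (fun s => 1 + ψ₁ s * a s) volume 0 T :=
    intervalIntegrable_const.add (ha.continuousOn_mul hc₁)
  have i₂ : IntervalIntegrable (fun s => 1 + ψ₂ s * a s) volume 0 T :=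
    intervalIntegrable_const.add (ha.continuousOn_mul hc₂)
  have hd : ∀ t ∈ Set.uIcc 0 T, ψ₁ t - ψ₂ t =
      (-∫ s in T..t, (1 + ψ₁ s * a s)) - -∫ s in T..t, (1 + ψ₂ s * a s) := fun t ht => by
    rw [h₁ t ht, h₂ t ht, intervalIntegral.integral_symm T t, intervalIntegral.integral_symm T t]
  have hAC := ((i₁.absolutelyContinuousOnInterval_intervalIntegral
    (c := T) Set.right_mem_uIcc).fun_neg).fun_sub (i₂.absolutelyContinuousOnInterval_intervalIntegral
    (c := T) Set.right_mem_uIcc).fun_neg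
  have := hAC.eq_zero_of_linear ha.neg (c := T) ?_ Set.right_mem_uIcc (by simp)
  · intro t ht
    have h := this t ht
    rw [← hd t ht] at h
    exact sub_eq_zero.1 h
  · filter_upwards [ae_hasDerivAt_primitive i₁ Set.right_mem_uIcc,
      ae_hasDerivAt_primitive i₂ Set.right_mem_uIcc] with x h1 h2 hx
    convert! (h1 hx).fun_neg.sub (h2 hx).fun_neg using 1
    rw [← hd x hx]
    simp only [Pi.neg_apply]
    ring

theorem linear_ode_solution_unique {z₁ z₂ g : ℝ → ℝ} (hT : 0 ≤ T)
    (ha : IntervalIntegrable a volume 0 T) (hg : IntervalIntegrable g volume 0 T)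
    (hc₁ : ContinuousOn z₁ (Set.Icc 0 T)) (hc₂ : ContinuousOn z₂ (Set.Icc 0 T))
    (h₁ : ∀ t ∈ Set.Icc 0 T, z₁ t = ∫ s in (0 : ℝ)..t, (a s * z₁ s + g s))
    (h₂ : ∀ t ∈ Set.Icc 0 T, z₂ t = ∫ s in (0 : ℝ)..t, (a s * z₂ s + g s)) :
    Set.EqOn z₁ z₂ (Set.Icc 0 T) := by
  rw [← Set.uIcc_of_le hT] at *
  have i₁ := (ha.mul_continuousOn hc₁).add hg
  have i₂ := (ha.mul_continuousOn hc₂).add hg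
  have hd : ∀ t ∈ Set.uIcc 0 T, z₁ t - z₂ t =
      (∫ s in (0 : ℝ)..t, (a s * z₁ s + g s)) - ∫ s in (0 : ℝ)..t, (a s * z₂ s + g s) :=
    fun t ht => by rw [h₁ t ht, h₂ t ht]
  have hAC := (i₁.absolutelyContinuousOnInterval_intervalIntegral
    (c := 0) Set.left_mem_uIcc).fun_sub (i₂.absolutelyContinuousOnInterval_intervalIntegral
    (c := 0) Set.left_mem_uIcc)
  have := hAC.eq_zero_of_linear ha (c := 0) ?_ Set.left_mem_uIcc (by simp)
  · intro t ht
    have h := (hd t ht).trans (this t ht)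
    exact sub_eq_zero.1 h
  · filter_upwards [ae_hasDerivAt_primitive i₁ Set.left_mem_uIcc,
      ae_hasDerivAt_primitive i₂ Set.left_mem_uIcc] with x h1 h2 hx
    convert! (h1 hx).sub (h2 hx) using 1
    rw [← hd x hx]
    ring

end LinearODE

/-! ### Brownian increments and the isometry for elementary sums -/

theorem MeasureTheory.MemLp.eLpNorm_two_eq {α : Type*} {m : MeasurableSpace α} {μ : Measure α}
    {f : α → ℝ} (hf : MemLp f 2 μ) :
    eLpNorm f 2 μ = ENNReal.ofReal (Real.sqrt (∫ x, f x ^ 2 ∂μ)) := by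
  rw [hf.eLpNorm_eq_integral_rpow_norm (by simp) (by simp), Real.sqrt_eq_rpow]
  simp

namespace IsBrownianMotionFor

variable {Ω : Type*} {mΩ : MeasurableSpace Ω} {P : Measure Ω} {𝓕 : Filtration ℝ≥0 mΩ}
  {W : ℝ≥0 → Ω → ℝ}

theorem stronglyMeasurable_increment (hW : IsBrownianMotionFor P 𝓕 W) {s t u : ℝ≥0} (hs : s ≤ u)
    (ht : t ≤ u) : StronglyMeasurable[𝓕 u] (fun ω => W t ω - W s ω) :=
  ((hW.adapted t).mono (𝓕.mono ht)).sub ((hW.adapted s).mono (𝓕.mono hs))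

theorem hasLaw_increment (hW : IsBrownianMotionFor P 𝓕 W) (s t : ℝ≥0) :
    HasLaw (fun ω => W t ω - W s ω) (gaussianReal 0 (nndist t.1 s.1)) P :=
  hW.brownian.toIsPreBrownianReal.hasLaw_sub t s

theorem memLp_increment (hW : IsBrownianMotionFor P 𝓕 W) (s t : ℝ≥0) :
    MemLp (fun ω => W t ω - W s ω) 2 P := by
  have h := hW.hasLaw_increment s t
  have h2 := memLp_id_gaussianReal' (μ := 0) (v := nndist t.1 s.1) 2 (by simp)
  rw [← h.map_eq] at h2
  exact (memLp_map_measure_iff (by fun_prop) h.aemeasurable).1 h2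

theorem integral_increment (hW : IsBrownianMotionFor P 𝓕 W) (s t : ℝ≥0) :
    ∫ ω, (W t ω - W s ω) ∂P = 0 := by
  rw [(hW.hasLaw_increment s t).integral_eq, integral_id_gaussianReal]

theorem integral_increment_sq [IsProbabilityMeasure P] (hW : IsBrownianMotionFor P 𝓕 W)
    {s t : ℝ≥0} (hst : s ≤ t) : ∫ ω, (W t ω - W s ω) ^ 2 ∂P = (t : ℝ) - s := by
  have h := hW.hasLaw_increment s t
  have hv := h.variance_eq
  rw [variance_id_gaussianReal, variance_of_integral_eq_zero h.aemeasurable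
    (hW.integral_increment s t)] at hv
  rw [hv, coe_nndist, Real.dist_eq]
  exact abs_of_nonneg (sub_nonneg.2 (NNReal.coe_le_coe.2 hst))

theorem indepFun_increment (hW : IsBrownianMotionFor P 𝓕 W) {s t : ℝ≥0} (hst : s ≤ t)
    {X : Ω → ℝ} (hX : StronglyMeasurable[𝓕 s] X) :
    IndepFun X (fun ω => W t ω - W s ω) P := by
  rw [IndepFun_iff_Indep]
  exact (indep_of_indep_of_le_right (hW.indep s t hst) hX.measurable.comap_le).symm

theorem integrable_mul_increment [IsProbabilityMeasure P]
    (hW : IsBrownianMotionFor P 𝓕 W) {s t : ℝ≥0} (hst : s ≤ t)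
    {X : Ω → ℝ} (hX : StronglyMeasurable[𝓕 s] X) (hi : Integrable X P) :
    Integrable (fun ω => X ω * (W t ω - W s ω)) P :=
  (hW.indepFun_increment hst hX).integrable_mul hi ((hW.memLp_increment s t).integrable (by simp))

theorem integral_mul_increment (hW : IsBrownianMotionFor P 𝓕 W) {s t : ℝ≥0} (hst : s ≤ t)
    {X : Ω → ℝ} (hX : StronglyMeasurable[𝓕 s] X) (hi : Integrable X P) :
    ∫ ω, X ω * (W t ω - W s ω) ∂P = 0 := by
  rw [(hW.indepFun_increment hst hX).integral_fun_mul_eq_mul_integral hi.aestronglyMeasurable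
    (hW.memLp_increment s t).aestronglyMeasurable, hW.integral_increment, mul_zero]

theorem indepFun_increment_sq (hW : IsBrownianMotionFor P 𝓕 W) {s t : ℝ≥0} (hst : s ≤ t)
    {X : Ω → ℝ} (hX : StronglyMeasurable[𝓕 s] X) :
    IndepFun X (fun ω => (W t ω - W s ω) ^ 2) P :=
  (hW.indepFun_increment hst hX).comp measurable_id (measurable_id.pow_const 2)

theorem integrable_mul_increment_sq (hW : IsBrownianMotionFor P 𝓕 W) {s t : ℝ≥0} (hst : s ≤ t)
    {X : Ω → ℝ} (hX : StronglyMeasurable[𝓕 s] X) (hi : Integrable X P) :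
    Integrable (fun ω => X ω * (W t ω - W s ω) ^ 2) P :=
  (hW.indepFun_increment_sq hst hX).integrable_mul hi (hW.memLp_increment s t).integrable_sq

theorem integral_mul_increment_sq [IsProbabilityMeasure P]
    (hW : IsBrownianMotionFor P 𝓕 W) {s t : ℝ≥0} (hst : s ≤ t)
    {X : Ω → ℝ} (hX : StronglyMeasurable[𝓕 s] X) (hi : Integrable X P) :
    ∫ ω, X ω * (W t ω - W s ω) ^ 2 ∂P = (∫ ω, X ω ∂P) * (t - s) := by
  rw [(hW.indepFun_increment_sq hst hX).integral_fun_mul_eq_mul_integral hi.aestronglyMeasurable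
    (hW.memLp_increment s t).integrable_sq.aestronglyMeasurable, hW.integral_increment_sq hst]

theorem memLp_mul_increment [IsProbabilityMeasure P]
    (hW : IsBrownianMotionFor P 𝓕 W) {s t : ℝ≥0} (hst : s ≤ t)
    {X : Ω → ℝ} (hX : StronglyMeasurable[𝓕 s] X) (hi : MemLp X 2 P) :
    MemLp (fun ω => X ω * (W t ω - W s ω)) 2 P := by
  refine (memLp_two_iff_integrable_sq
    (hi.aestronglyMeasurable.mul (hW.memLp_increment s t).aestronglyMeasurable)).2 ?_
  simp only [Pi.mul_apply, mul_pow]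
  exact hW.integrable_mul_increment_sq hst (hX.pow 2) hi.integrable_sq

/-- For `b ≤ d`, split `W d - W c` at `b`: the first piece yields a square, and the second is
independent of the `𝓕 b`-measurable remaining factor and has mean zero. -/
theorem integral_mul_increment_mul_increment [IsProbabilityMeasure P]
    (hW : IsBrownianMotionFor P 𝓕 W) {c b d : ℝ≥0}
    (hcb : c ≤ b) (hcd : c ≤ d) {Z : Ω → ℝ} (hZ : StronglyMeasurable[𝓕 c] Z)
    (hi : Integrable Z P) :
    Integrable (fun ω => Z ω * (W b ω - W c ω) * (W d ω - W c ω)) P ∧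
    ∫ ω, Z ω * (W b ω - W c ω) * (W d ω - W c ω) ∂P = (∫ ω, Z ω ∂P) * (min (b : ℝ) d - c) := by
  wlog hbd : b ≤ d generalizing b d
  · have := this hcd hcb (le_of_not_ge hbd)
    rw [min_comm]
    simpa only [mul_right_comm] using this
  have e : (fun ω => Z ω * (W b ω - W c ω) * (W d ω - W c ω)) =
      fun ω => Z ω * (W b ω - W c ω) ^ 2 + Z ω * (W b ω - W c ω) * (W d ω - W b ω) := by
    ext ω; ring
  have hm : StronglyMeasurable[𝓕 b] (fun ω => Z ω * (W b ω - W c ω)) :=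
    (hZ.mono (𝓕.mono hcb)).mul (hW.stronglyMeasurable_increment hcb le_rfl)
  have i1 := hW.integrable_mul_increment_sq hcb hZ hi
  have i0 := hW.integrable_mul_increment hcb hZ hi
  have i2 := hW.integrable_mul_increment hbd hm i0
  rw [e]
  refine ⟨i1.add i2, ?_⟩
  rw [integral_add i1 i2, hW.integral_mul_increment_sq hcb hZ hi,
    hW.integral_mul_increment hbd hm i0, add_zero, min_eq_left (NNReal.coe_le_coe.2 hbd)]

/-- The `max` is the length of the overlap of the two intervals. For `a ≤ c`, the part of the first
increment before `c` is known at time `c` and contributes nothing; what is left starts at `c` in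
both factors. -/
theorem integral_elementary_mul_elementary [IsProbabilityMeasure P]
    (hW : IsBrownianMotionFor P 𝓕 W) {a b c d : ℝ≥0}
    (hab : a ≤ b) (hcd : c ≤ d) {ξ η : Ω → ℝ} (hξ : StronglyMeasurable[𝓕 a] ξ)
    (hη : StronglyMeasurable[𝓕 c] η) (hξ2 : MemLp ξ 2 P) (hη2 : MemLp η 2 P) :
    ∫ ω, ξ ω * (W b ω - W a ω) * (η ω * (W d ω - W c ω)) ∂P =
      (∫ ω, ξ ω * η ω ∂P) * max (min (b : ℝ) d - max (a : ℝ) c) 0 := by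
  wlog hac : a ≤ c generalizing a b c d ξ η
  · have := this hcd hab hη hξ hη2 hξ2 (le_of_not_ge hac)
    rw [min_comm, max_comm (a : ℝ)]
    simpa only [mul_comm] using this
  have hξc := hξ.mono (𝓕.mono hac)
  have key : ∀ b' : ℝ≥0, a ≤ b' → b' ≤ c →
      Integrable (fun ω => ξ ω * (W b' ω - W a ω) * (η ω * (W d ω - W c ω))) P ∧
      ∫ ω, ξ ω * (W b' ω - W a ω) * (η ω * (W d ω - W c ω)) ∂P = 0 := by
    intro b' hab' hb'
    have hm : StronglyMeasurable[𝓕 c] (fun ω => ξ ω * (W b' ω - W a ω) * η ω) :=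
      (hξc.mul (hW.stronglyMeasurable_increment hac hb')).mul hη
    have hi : Integrable (fun ω => ξ ω * (W b' ω - W a ω) * η ω) P :=
      (hW.memLp_mul_increment hab' hξ hξ2).integrable_mul hη2
    have i1 := hW.integrable_mul_increment hcd hm hi
    have i2 := hW.integral_mul_increment hcd hm hi
    simp only [mul_assoc] at i1 i2 ⊢
    exact ⟨i1, i2⟩
  have hac' := NNReal.coe_le_coe.2 hac
  rcases le_total b c with hbc | hcb
  · rw [(key b hab hbc).2, max_eq_right, mul_zero]
    have := NNReal.coe_le_coe.2 hbc
    rw [max_eq_right hac']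
    linarith [min_le_left (b : ℝ) d]
  · have hZ := hW.integral_mul_increment_mul_increment hcb hcd (hξc.mul hη)
      (hξ2.integrable_mul hη2)
    have e : (fun ω => ξ ω * (W b ω - W a ω) * (η ω * (W d ω - W c ω))) = fun ω =>
        ξ ω * (W c ω - W a ω) * (η ω * (W d ω - W c ω)) +
        (ξ * η) ω * (W b ω - W c ω) * (W d ω - W c ω) := by
      ext ω; simp only [Pi.mul_apply]; ring
    rw [e, integral_add (key c hac le_rfl).1 hZ.1, (key c hac le_rfl).2, hZ.2, zero_add,
      max_eq_right hac', max_eq_left]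
    · rfl
    · have h1 := NNReal.coe_le_coe.2 hcb
      have h2 := NNReal.coe_le_coe.2 hcd
      linarith [le_min h1 h2]

end IsBrownianMotionFor

theorem memLp_indicator_Ioc {Ω : Type*} {mΩ : MeasurableSpace Ω} {P : Measure Ω}
    [IsProbabilityMeasure P] {ξ : Ω → ℝ} (hξ : MemLp ξ 2 P) (t a b : ℝ) :
    MemLp (fun p : ℝ × Ω => (Set.Ioc a b).indicator (fun _ => ξ p.2) p.1) 2
      ((timeMeasure t).prod P) := by
  have : MemLp ((Set.Ioc a b ×ˢ Set.univ).indicator (fun p : ℝ × Ω => ξ p.2)) 2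
      ((timeMeasure t).prod P) :=
    (hξ.comp_snd (timeMeasure t)).indicator (measurableSet_Ioc.prod .univ)
  refine (memLp_congr_ae (.of_forall fun p => ?_)).1 this
  simp [Set.indicator_apply]

/-- The time-space side of the isometry: the same overlap length appears as the measure of an
intersection. -/
theorem integral_indicator_Ioc_mul {Ω : Type*} {mΩ : MeasurableSpace Ω} {P : Measure Ω}
    [IsProbabilityMeasure P] (ξ η : Ω → ℝ) {t a b c d : ℝ} (ha : 0 ≤ a) (hb : b ≤ t) :
    ∫ p : ℝ × Ω, (Set.Ioc a b).indicator (fun _ => ξ p.2) p.1 *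
      (Set.Ioc c d).indicator (fun _ => η p.2) p.1 ∂((timeMeasure t).prod P) =
    (∫ ω, ξ ω * η ω ∂P) * max (min b d - max a c) 0 := by
  have e : (fun p : ℝ × Ω => (Set.Ioc a b).indicator (fun _ => ξ p.2) p.1 *
      (Set.Ioc c d).indicator (fun _ => η p.2) p.1) = fun p : ℝ × Ω =>
      (Set.Ioc (max a c) (min b d)).indicator (1 : ℝ → ℝ) p.1 * (ξ p.2 * η p.2) := by
    ext p
    rw [← Set.Ioc_inter_Ioc]
    by_cases h1 : p.1 ∈ Set.Ioc a b <;> by_cases h2 : p.1 ∈ Set.Ioc c d <;>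
      simp [h1, h2, -Set.mem_Ioc]
  rw [e, integral_prod_mul (μ := timeMeasure t) (ν := P)
    (fun s => (Set.Ioc (max a c) (min b d)).indicator (1 : ℝ → ℝ) s) (fun ω => ξ ω * η ω),
    integral_indicator_one measurableSet_Ioc, mul_comm, measureReal_restrict_apply measurableSet_Ioc,
    Set.inter_eq_left.2, Real.volume_real_Ioc]
  exact fun x hx => ⟨(ha.trans (le_max_left _ _)).trans hx.1.le,
    (hx.2.trans (min_le_left _ _)).trans hb⟩

/-- Both squared norms expand into Gram matrices that agree entry by entry. The intervals may
overlap, so differences of simple processes on unrelated partitions are covered without a common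
refinement. -/
theorem IsBrownianMotionFor.eLpNorm_sum_elementary {Ω : Type*} {mΩ : MeasurableSpace Ω}
    {P : Measure Ω} [IsProbabilityMeasure P] {𝓕 : Filtration ℝ≥0 mΩ} {W : ℝ≥0 → Ω → ℝ}
    (hW : IsBrownianMotionFor P 𝓕 W) {ι : Type*} (s : Finset ι) {a b : ι → ℝ≥0}
    {ξ : ι → Ω → ℝ} {t : ℝ≥0} (hab : ∀ i, a i ≤ b i) (hb : ∀ i, b i ≤ t)
    (hξ : ∀ i, StronglyMeasurable[𝓕 (a i)] (ξ i)) (hξ2 : ∀ i, MemLp (ξ i) 2 P) :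
    eLpNorm (fun ω => ∑ i ∈ s, ξ i ω * (W (b i) ω - W (a i) ω)) 2 P =
    eLpNorm (fun p : ℝ × Ω => ∑ i ∈ s,
      (Set.Ioc (a i : ℝ) (b i : ℝ)).indicator (fun _ => ξ i p.2) p.1) 2
      ((timeMeasure t).prod P) := by
  have m1 : ∀ i, MemLp (fun ω => ξ i ω * (W (b i) ω - W (a i) ω)) 2 P := fun i =>
    hW.memLp_mul_increment (hab i) (hξ i) (hξ2 i)
  have m2 : ∀ i, MemLp (fun p : ℝ × Ω => (Set.Ioc (a i : ℝ) (b i : ℝ)).indicator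
      (fun _ => ξ i p.2) p.1) 2 ((timeMeasure t).prod P) := fun i =>
    memLp_indicator_Ioc (hξ2 i) _ _ _
  rw [(memLp_finsetSum s fun i _ => m1 i).eLpNorm_two_eq,
    (memLp_finsetSum s fun i _ => m2 i).eLpNorm_two_eq]
  congr 2
  have i1 := fun i j => (m1 i).integrable_mul (m1 j)
  have i2 := fun i j => (m2 i).integrable_mul (m2 j)
  simp only [Pi.mul_def] at i1 i2
  simp_rw [pow_two, Finset.sum_mul_sum]
  rw [integral_finsetSum _ fun i _ => integrable_finsetSum _ fun j _ => i1 i j,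
    integral_finsetSum _ fun i _ => integrable_finsetSum _ fun j _ => i2 i j]
  refine Finset.sum_congr rfl fun i _ => ?_
  rw [integral_finsetSum _ fun j _ => i1 i j, integral_finsetSum _ fun j _ => i2 i j]
  refine Finset.sum_congr rfl fun j _ => ?_
  rw [hW.integral_elementary_mul_elementary (hab i) (hab j) (hξ i) (hξ j) (hξ2 i) (hξ2 j),
    integral_indicator_Ioc_mul _ _ (NNReal.coe_nonneg _) (NNReal.coe_le_coe.2 (hb i))]

/-! ### Elementary stochastic integrals -/

namespace SimpleProcess

variable {Ω : Type*} {mΩ : MeasurableSpace Ω} {P : Measure Ω} {𝓕 : Filtration ℝ≥0 mΩ}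
  {W : ℝ≥0 → Ω → ℝ}

open Classical in
/-- The `k`-th coefficient of a simple process, replaced by zero if its interval starts after
time `t`. -/
noncomputable def truncCoeff (S : SimpleProcess P 𝓕) (t : ℝ≥0) (k : ℕ) : Ω → ℝ :=
  if S.τ k ≤ t then S.ξ k else 0

/-- The replacement by zero is what makes this hold: for `t < τ k` the original coefficient need not
be `𝓕 t`-measurable, while its interval stopped at `t` is empty. -/
theorem stronglyMeasurable_truncCoeff (S : SimpleProcess P 𝓕) (t : ℝ≥0) (k : ℕ) :
    StronglyMeasurable[𝓕 (min (S.τ k) t)] (S.truncCoeff t k) := by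
  unfold truncCoeff
  split_ifs with h
  · rw [min_eq_left h]
    exact S.meas k
  · exact stronglyMeasurable_zero

theorem memLp_truncCoeff (S : SimpleProcess P 𝓕) (t : ℝ≥0) (k : ℕ) :
    MemLp (S.truncCoeff t k) 2 P := by
  unfold truncCoeff
  split_ifs
  exacts [S.memLp k, MemLp.zero]

theorem min_mono (S : SimpleProcess P 𝓕) (t : ℝ≥0) (k : ℕ) :
    min (S.τ k) t ≤ min (S.τ (k + 1)) t :=
  min_le_min_right _ (S.mono k.le_succ)

theorem integral_eq_truncCoeff (S : SimpleProcess P 𝓕) (W : ℝ≥0 → Ω → ℝ) (t : ℝ≥0) (ω : Ω) :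
    S.integral W t ω = ∑ k ∈ Finset.range S.n,
      S.truncCoeff t k ω * (W (min (S.τ (k + 1)) t) ω - W (min (S.τ k) t) ω) := by
  refine Finset.sum_congr rfl fun k _ => ?_
  unfold truncCoeff
  split_ifs with h
  · rfl
  · have h1 : t ≤ S.τ k := (not_le.1 h).le
    rw [min_eq_right h1, min_eq_right (h1.trans (S.mono k.le_succ)), sub_self, mul_zero, mul_zero]

theorem eval_eq_truncCoeff (S : SimpleProcess P 𝓕) (t : ℝ≥0) {r : ℝ} (hr : r ≤ t) (ω : Ω) :
    S.eval r ω = ∑ k ∈ Finset.range S.n,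
      (Set.Ioc (min (S.τ k) t : ℝ≥0) (min (S.τ (k + 1)) t : ℝ≥0) : Set ℝ).indicator
        (fun _ => S.truncCoeff t k ω) r := by
  refine Finset.sum_congr rfl fun k _ => ?_
  unfold truncCoeff
  have hm : ∀ k, (S.τ k : ℝ) < r → S.τ k ≤ t := fun k h => NNReal.coe_le_coe.1 (h.le.trans hr)
  simp only [Set.indicator_apply, Set.mem_Ioc, NNReal.coe_min, min_lt_iff, le_min_iff, hr,
    and_true, not_lt_of_ge hr, or_false]
  by_cases h : (S.τ k : ℝ) < r
  · simp [h, hm k h]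
  · simp [h]

theorem memLp_eval [IsProbabilityMeasure P] (S : SimpleProcess P 𝓕) (t : ℝ) :
    MemLp (fun p : ℝ × Ω => S.eval p.1 p.2) 2 ((timeMeasure t).prod P) :=
  memLp_finsetSum _ fun k _ => memLp_indicator_Ioc (S.memLp k) _ _ _

theorem memLp_integral [IsProbabilityMeasure P] (hW : IsBrownianMotionFor P 𝓕 W)
    (S : SimpleProcess P 𝓕) (t : ℝ≥0) : MemLp (S.integral W t) 2 P := by
  have : S.integral W t = fun ω => ∑ k ∈ Finset.range S.n,
      S.truncCoeff t k ω * (W (min (S.τ (k + 1)) t) ω - W (min (S.τ k) t) ω) :=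
    funext fun ω => S.integral_eq_truncCoeff W t ω
  rw [this]
  exact memLp_finsetSum _ fun k _ => hW.memLp_mul_increment (S.min_mono t k)
    (S.stronglyMeasurable_truncCoeff t k) (S.memLp_truncCoeff t k)

theorem stronglyMeasurable_integral (hW : IsBrownianMotionFor P 𝓕 W)
    (S : SimpleProcess P 𝓕) (t : ℝ≥0) : StronglyMeasurable[𝓕 t] (S.integral W t) := by
  have : S.integral W t = fun ω => ∑ k ∈ Finset.range S.n,
      S.truncCoeff t k ω * (W (min (S.τ (k + 1)) t) ω - W (min (S.τ k) t) ω) :=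
    funext fun ω => S.integral_eq_truncCoeff W t ω
  rw [this]
  exact Finset.stronglyMeasurable_fun_sum _ fun k _ =>
    ((S.stronglyMeasurable_truncCoeff t k).mono (𝓕.mono (min_le_right _ _))).mul
      (hW.stronglyMeasurable_increment (min_le_right _ _) (min_le_right _ _))

theorem integral_integral_eq_zero [IsProbabilityMeasure P] (hW : IsBrownianMotionFor P 𝓕 W)
    (S : SimpleProcess P 𝓕) (t : ℝ≥0) : ∫ ω, S.integral W t ω ∂P = 0 := by
  simp_rw [integral_eq_truncCoeff]
  have hi := fun k => (S.memLp_truncCoeff t k).integrable (by simp)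
  rw [integral_finsetSum _ fun k _ => hW.integrable_mul_increment (S.min_mono t k)
    (S.stronglyMeasurable_truncCoeff t k) (hi k)]
  exact Finset.sum_eq_zero fun k _ => hW.integral_mul_increment (S.min_mono t k)
    (S.stronglyMeasurable_truncCoeff t k) (hi k)

theorem ae_timeMeasure_prod_le [SFinite P] (t : ℝ) :
    ∀ᵐ p ∂((timeMeasure t).prod P), p.1 ∈ Set.Icc 0 t :=
  Measure.quasiMeasurePreserving_fst.ae (ae_restrict_mem measurableSet_Icc)

/-- The Itô isometry for the difference of two simple processes. -/
theorem eLpNorm_integral_sub [IsProbabilityMeasure P] (hW : IsBrownianMotionFor P 𝓕 W)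
    (S S' : SimpleProcess P 𝓕) (t : ℝ≥0) :
    eLpNorm (fun ω => S.integral W t ω - S'.integral W t ω) 2 P =
    eLpNorm (fun p : ℝ × Ω => S.eval p.1 p.2 - S'.eval p.1 p.2) 2
      ((timeMeasure t).prod P) := by
  -- The difference is a single elementary sum over the disjoint union of the two index sets, with
  -- the coefficients of `S'` negated.
  have key := hW.eLpNorm_sum_elementary ((Finset.range S.n).disjSum (Finset.range S'.n))
    (a := Sum.elim (fun k => min (S.τ k) t) (fun k => min (S'.τ k) t))
    (b := Sum.elim (fun k => min (S.τ (k + 1)) t) (fun k => min (S'.τ (k + 1)) t))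
    (ξ := Sum.elim (S.truncCoeff t) (fun k => -S'.truncCoeff t k)) (t := t)
    (Sum.rec (S.min_mono t) (S'.min_mono t))
    (Sum.rec (fun _ => min_le_right _ _) (fun _ => min_le_right _ _))
    (Sum.rec (S.stronglyMeasurable_truncCoeff t)
      fun k => (S'.stronglyMeasurable_truncCoeff t k).neg)
    (Sum.rec (S.memLp_truncCoeff t) fun k => (S'.memLp_truncCoeff t k).neg)
  simp only [Finset.sum_disjSum, Sum.elim_inl, Sum.elim_inr, Pi.neg_apply, neg_mul,
    Finset.sum_neg_distrib, ← integral_eq_truncCoeff] at key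
  simp only [sub_eq_add_neg]
  rw [key]
  refine eLpNorm_congr_ae ?_
  filter_upwards [ae_timeMeasure_prod_le (P := P) t] with p hp
  rw [S.eval_eq_truncCoeff t hp.2, S'.eval_eq_truncCoeff t hp.2, ← Finset.sum_neg_distrib]
  congr 1
  refine Finset.sum_congr rfl fun k _ => ?_
  simp only [Set.indicator_apply]
  split_ifs <;> simp

theorem eLpNorm_mul_increment [IsProbabilityMeasure P] (hW : IsBrownianMotionFor P 𝓕 W)
    {s t : ℝ≥0} (hst : s ≤ t) {X : Ω → ℝ} (hX : StronglyMeasurable[𝓕 s] X) (hi : MemLp X 2 P) :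
    eLpNorm (fun ω => X ω * (W t ω - W s ω)) 2 P =
      ENNReal.ofReal (Real.sqrt ((∫ ω, X ω ^ 2 ∂P) * (t - s))) := by
  rw [(hW.memLp_mul_increment hst hX hi).eLpNorm_two_eq]
  simp_rw [mul_pow]
  rw [hW.integral_mul_increment_sq hst (X := fun ω => X ω ^ 2) (hX.pow 2) hi.integrable_sq]

/-- The increment over `[s, t]` is a sum over the intervals of `S` clipped to `[s, t]`, each of
length at most `t - s`. The triangle inequality suffices since only continuity in time is wanted,
and `C` may depend on `S`. -/
theorem exists_eLpNorm_integral_sub_le [IsProbabilityMeasure P] (hW : IsBrownianMotionFor P 𝓕 W)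
    (S : SimpleProcess P 𝓕) : ∃ C : ℝ, ∀ s t : ℝ≥0, s ≤ t →
      eLpNorm (fun ω => S.integral W t ω - S.integral W s ω) 2 P ≤
        ENNReal.ofReal (C * Real.sqrt (t - s)) := by
  refine ⟨∑ k ∈ Finset.range S.n, Real.sqrt (∫ ω, S.ξ k ω ^ 2 ∂P), fun s t hst => ?_⟩
  have hst' : (0 : ℝ) ≤ t - s := sub_nonneg.2 (NNReal.coe_le_coe.2 hst)
  have e : (fun ω => S.integral W t ω - S.integral W s ω) = ∑ k ∈ Finset.range S.n, fun ω =>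
      S.truncCoeff t k ω * (W (max s (min (S.τ (k + 1)) t)) ω - W (max s (min (S.τ k) t)) ω) := by
    ext ω
    rw [integral, integral, ← Finset.sum_sub_distrib, Finset.sum_apply]
    refine Finset.sum_congr rfl fun k _ => ?_
    have hc : ∀ r : ℝ≥0, W (min r t) ω - W (min r s) ω = W (max s (min r t)) ω - W s ω := by
      intro r
      rcases le_total r s with h | h
      · rw [min_eq_left h, min_eq_left (h.trans hst), max_eq_left h, sub_self, sub_self]
      · rw [min_eq_right h, max_eq_right (le_min h hst)]
    have h1 := hc (S.τ k)
    have h2 := hc (S.τ (k + 1))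
    unfold truncCoeff
    split_ifs with h
    · linear_combination (S.ξ k ω) * h2 - (S.ξ k ω) * h1
    · have h3 : t ≤ S.τ k := (not_le.1 h).le
      rw [min_eq_right h3, min_eq_right (h3.trans (S.mono k.le_succ)),
        min_eq_right (hst.trans h3), min_eq_right ((hst.trans h3).trans (S.mono k.le_succ))]
      simp
  have hX : ∀ k, StronglyMeasurable[𝓕 (max s (min (S.τ k) t))] (S.truncCoeff t k) := fun k =>
    (S.stronglyMeasurable_truncCoeff t k).mono (𝓕.mono (le_max_right _ _))
  have hm : ∀ k, max s (min (S.τ k) t) ≤ max s (min (S.τ (k + 1)) t) := fun k =>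
    max_le_max_left _ (S.min_mono t k)
  rw [e, Finset.sum_mul, ENNReal.ofReal_sum_of_nonneg fun _ _ => by positivity]
  refine (eLpNorm_sum_le (fun k _ => (hW.memLp_mul_increment (hm k) (hX k)
    (S.memLp_truncCoeff t k)).aestronglyMeasurable) (by norm_num)).trans
    (Finset.sum_le_sum fun k _ => ?_)
  rw [eLpNorm_mul_increment hW (hm k) (hX k) (S.memLp_truncCoeff t k), ← Real.sqrt_mul
    (integral_nonneg fun _ => sq_nonneg _)]
  refine ENNReal.ofReal_le_ofReal (Real.sqrt_le_sqrt ?_)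
  have h1 : (s : ℝ) ≤ (max s (min (S.τ k) t) : ℝ≥0) := NNReal.coe_le_coe.2 (le_max_left _ _)
  have h2 : ((max s (min (S.τ (k + 1)) t) : ℝ≥0) : ℝ) ≤ t :=
    NNReal.coe_le_coe.2 (max_le hst (min_le_right _ _))
  refine mul_le_mul ?_ (by linarith) (sub_nonneg.2 (NNReal.coe_le_coe.2 (hm k)))
    (integral_nonneg fun _ => sq_nonneg _)
  unfold truncCoeff
  split_ifs
  · rfl
  · simpa using integral_nonneg fun ω => sq_nonneg (S.ξ k ω)

end SimpleProcess

/-! ### Itô integrals as limits of elementary integrals -/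

theorem timeMeasure_prod_mono {Ω : Type*} {mΩ : MeasurableSpace Ω} (P : Measure Ω) [SFinite P]
    {s t : ℝ} (hst : s ≤ t) : (timeMeasure s).prod P ≤ (timeMeasure t).prod P :=
  Measure.prod_mono (Measure.restrict_mono (Set.Icc_subset_Icc_right hst) le_rfl) le_rfl

namespace IsItoIntegral

variable {Ω : Type*} {mΩ : MeasurableSpace Ω} {P : Measure Ω} [IsProbabilityMeasure P]
  {𝓕 : Filtration ℝ≥0 mΩ} {W : ℝ≥0 → Ω → ℝ} {T : ℝ} {H H' : ℝ → Ω → ℝ} {I I' : ℝ≥0 → Ω → ℝ}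

/-- The Itô isometry for the difference of two Itô integrals. -/
theorem eLpNorm_sub_le (hW : IsBrownianMotionFor P 𝓕 W) (h : IsItoIntegral P 𝓕 W T H I)
    (h' : IsItoIntegral P 𝓕 W T H' I') {t : ℝ≥0} (ht : (t : ℝ) ≤ T) :
    eLpNorm (fun ω => I t ω - I' t ω) 2 P ≤
      eLpNorm (fun p : ℝ × Ω => H p.1 p.2 - H' p.1 p.2) 2 ((timeMeasure t).prod P) := by
  obtain ⟨S, hS, hI⟩ := h.approx
  obtain ⟨S', hS', hI'⟩ := h'.approx
  have hμ := timeMeasure_prod_mono P ht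
  -- Of the five terms of the triangle inequality only the middle one survives. It is kept on `[0,
  -- t]` rather than `[0, T]`, which the exponentially weighted estimate later relies on.
  have lim : Tendsto (fun l => eLpNorm (fun ω => (S l).integral W t ω - I t ω) 2 P +
      (eLpNorm (fun p : ℝ × Ω => (S l).eval p.1 p.2 - H p.1 p.2) 2 ((timeMeasure T).prod P) +
      eLpNorm (fun p : ℝ × Ω => H p.1 p.2 - H' p.1 p.2) 2 ((timeMeasure t).prod P) +
      eLpNorm (fun p : ℝ × Ω => (S' l).eval p.1 p.2 - H' p.1 p.2) 2 ((timeMeasure T).prod P)) +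
      eLpNorm (fun ω => (S' l).integral W t ω - I' t ω) 2 P) atTop
      (𝓝 (0 + (0 + eLpNorm (fun p : ℝ × Ω => H p.1 p.2 - H' p.1 p.2) 2
        ((timeMeasure t).prod P) + 0) + 0)) :=
    ((hI t ht).add ((hS.add tendsto_const_nhds).add hS')).add (hI' t ht)
  simp only [zero_add, add_zero] at lim
  refine ge_of_tendsto' lim fun l => ?_
  have mI := (h.integral_memLp t ht).aestronglyMeasurable
  have mI' := (h'.integral_memLp t ht).aestronglyMeasurable
  have mS := ((S l).memLp_integral hW t).aestronglyMeasurable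
  have mS' := ((S' l).memLp_integral hW t).aestronglyMeasurable
  have mH := h.integrand_memLp.aestronglyMeasurable.mono_measure hμ
  have mH' := h'.integrand_memLp.aestronglyMeasurable.mono_measure hμ
  have mE := ((S l).memLp_eval (t : ℝ)).aestronglyMeasurable
  have mE' := ((S' l).memLp_eval (t : ℝ)).aestronglyMeasurable
  have e1 : (fun ω => I t ω - I' t ω) = -(fun ω => (S l).integral W t ω - I t ω) +
      (fun ω => (S l).integral W t ω - (S' l).integral W t ω) +
      (fun ω => (S' l).integral W t ω - I' t ω) := by
    ext ω; simp
  have e2 : (fun p : ℝ × Ω => (S l).eval p.1 p.2 - (S' l).eval p.1 p.2) =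
      (fun p : ℝ × Ω => (S l).eval p.1 p.2 - H p.1 p.2) +
      (fun p : ℝ × Ω => H p.1 p.2 - H' p.1 p.2) +
      -(fun p : ℝ × Ω => (S' l).eval p.1 p.2 - H' p.1 p.2) := by
    ext p; simp
  rw [e1]
  refine (eLpNorm_add_le ((mS.sub mI).neg.add (mS.sub mS')) (mS'.sub mI') (by norm_num)).trans ?_
  gcongr ?_ + ?_
  swap
  · rfl
  refine (eLpNorm_add_le (mS.sub mI).neg (mS.sub mS') (by norm_num)).trans ?_
  rw [eLpNorm_neg]
  gcongr ?_ + ?_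
  · rfl
  refine (SimpleProcess.eLpNorm_integral_sub hW (S l) (S' l) t).trans_le ?_
  rw [e2]
  refine (eLpNorm_add_le ((mE.sub mH).add (mH.sub mH')) (mE'.sub mH').neg (by norm_num)).trans ?_
  rw [eLpNorm_neg]
  gcongr ?_ + ?_
  · refine (eLpNorm_add_le (mE.sub mH) (mH.sub mH') (by norm_num)).trans ?_
    gcongr ?_ + ?_
    · exact eLpNorm_mono_measure _ hμ
    · rfl
  · exact eLpNorm_mono_measure _ hμ

/-- The approximating elementary integrals, as elements of `L²`, converge. -/
theorem tendsto_toLp (hW : IsBrownianMotionFor P 𝓕 W) (h : IsItoIntegral P 𝓕 W T H I)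
    {S : ℕ → SimpleProcess P 𝓕} {t : ℝ≥0} (ht : (t : ℝ) ≤ T)
    (hS : Tendsto (fun l => eLpNorm (fun ω => (S l).integral W t ω - I t ω) 2 P) atTop (𝓝 0)) :
    Tendsto (fun l => ((S l).memLp_integral hW t).toLp) atTop
      (𝓝 (h.integral_memLp t ht).toLp) :=
  (Lp.tendsto_Lp_iff_tendsto_eLpNorm'' _ (fun l => (S l).memLp_integral hW t) _
    (h.integral_memLp t ht)).2 hS

/-- The mean is the inner product with the constant `1`, hence passes to the `L²` limit. -/
theorem integral_eq_zero (hW : IsBrownianMotionFor P 𝓕 W) (h : IsItoIntegral P 𝓕 W T H I)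
    {t : ℝ≥0} (ht : (t : ℝ) ≤ T) : ∫ ω, I t ω ∂P = 0 := by
  obtain ⟨S, -, hS⟩ := h.approx
  have h1 := (h.tendsto_toLp hW ht (hS t ht)).inner (𝕜 := ℝ)
    (tendsto_const_nhds (x := (memLp_const (1 : ℝ) : MemLp (fun _ : Ω => (1 : ℝ)) 2 P).toLp))
  have e : ∀ {f : Ω → ℝ} (hf : MemLp f 2 P), inner ℝ hf.toLp
      (memLp_const (1 : ℝ) : MemLp (fun _ : Ω => (1 : ℝ)) 2 P).toLp = ∫ ω, f ω ∂P := by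
    intro f hf
    rw [L2.inner_def]
    refine integral_congr_ae ?_
    filter_upwards [hf.coeFn_toLp,
      (memLp_const (1 : ℝ) : MemLp (fun _ : Ω => (1 : ℝ)) 2 P).coeFn_toLp] with ω h1 h2
    simp [h1]
  simp only [e, SimpleProcess.integral_integral_eq_zero hW] at h1
  exact tendsto_nhds_unique h1 tendsto_const_nhds

theorem toLp_mem_lpMeas (hW : IsBrownianMotionFor P 𝓕 W) (h : IsItoIntegral P 𝓕 W T H I)
    {t : ℝ≥0} (ht : (t : ℝ) ≤ T) :
    (h.integral_memLp t ht).toLp ∈ lpMeas ℝ ℝ (𝓕 t) 2 P := by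
  obtain ⟨S, -, hS⟩ := h.approx
  have : Fact (𝓕 t ≤ mΩ) := ⟨𝓕.le t⟩
  have hc : IsClosed (lpMeas ℝ ℝ (𝓕 t) 2 P : Set (Lp ℝ 2 P)) :=
    (completeSpace_coe_iff_isComplete.1
      (inferInstance : CompleteSpace (lpMeas ℝ ℝ (𝓕 t) 2 P))).isClosed
  refine hc.mem_of_tendsto (h.tendsto_toLp hW ht (hS t ht)) (.of_forall fun l => ?_)
  refine mem_lpMeas_iff_aestronglyMeasurable.2 ?_
  exact ((S l).stronglyMeasurable_integral hW t).aestronglyMeasurable.congr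
    ((S l).memLp_integral hW t).coeFn_toLp.symm

end IsItoIntegral

theorem SimpleProcess.isItoIntegral {Ω : Type*} {mΩ : MeasurableSpace Ω} {P : Measure Ω}
    [IsProbabilityMeasure P] {𝓕 : Filtration ℝ≥0 mΩ} {W : ℝ≥0 → Ω → ℝ}
    (hW : IsBrownianMotionFor P 𝓕 W) (S : SimpleProcess P 𝓕) (T : ℝ) :
    IsItoIntegral P 𝓕 W T S.eval (S.integral W) :=
  ⟨S.memLp_eval T, fun t _ => S.memLp_integral hW t, fun _ => S, by simp, by simp⟩

theorem SimpleProcess.continuous_toLp {Ω : Type*} {mΩ : MeasurableSpace Ω} {P : Measure Ω}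
    [IsProbabilityMeasure P] {𝓕 : Filtration ℝ≥0 mΩ} {W : ℝ≥0 → Ω → ℝ}
    (hW : IsBrownianMotionFor P 𝓕 W) (S : SimpleProcess P 𝓕) :
    Continuous (fun t : ℝ≥0 => (S.memLp_integral hW t).toLp) := by
  obtain ⟨C, hC⟩ := S.exists_eLpNorm_integral_sub_le hW
  have hb : ∀ s t : ℝ≥0, edist (S.memLp_integral hW s).toLp (S.memLp_integral hW t).toLp ≤
      ENNReal.ofReal (C * Real.sqrt |(s : ℝ) - t|) := by
    intro s t
    wlog hst : s ≤ t generalizing s t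
    · rw [edist_comm, abs_sub_comm]
      exact this t s (le_of_not_ge hst)
    rw [edist_comm, Lp.edist_toLp_toLp, abs_sub_comm,
      abs_of_nonneg (sub_nonneg.2 (NNReal.coe_le_coe.2 hst))]
    exact hC s t hst
  rw [continuous_iff_continuousAt]
  intro t
  rw [ContinuousAt, tendsto_iff_edist_tendsto_0]
  refine tendsto_of_tendsto_of_tendsto_of_le_of_le tendsto_const_nhds ?_
    (fun _ => zero_le) (fun s => hb s t)
  have : Continuous (fun s : ℝ≥0 => ENNReal.ofReal (C * Real.sqrt |(s : ℝ) - t|)) :=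
    ENNReal.continuous_ofReal.comp (by fun_prop)
  simpa using this.tendsto t

/-- The isometry bounds the approximation error by a norm over `[0, T]` that does not depend on `t`,
so the limit of the continuous elementary curves is uniform. -/
theorem IsItoIntegral.continuous_toLp {Ω : Type*} {mΩ : MeasurableSpace Ω} {P : Measure Ω}
    [IsProbabilityMeasure P] {𝓕 : Filtration ℝ≥0 mΩ} {W : ℝ≥0 → Ω → ℝ} {T : ℝ}
    {H : ℝ → Ω → ℝ} {I : ℝ≥0 → Ω → ℝ} (hW : IsBrownianMotionFor P 𝓕 W)
    (h : IsItoIntegral P 𝓕 W T H I) :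
    Continuous (fun t : Set.Icc 0 T => (h.integral_memLp ⟨t, t.2.1⟩ t.2.2).toLp) := by
  obtain ⟨S, hS, -⟩ := h.approx
  have hu : TendstoUniformly (fun l (t : Set.Icc 0 T) =>
      ((S l).memLp_integral hW ⟨t, t.2.1⟩).toLp)
      (fun t : Set.Icc 0 T => (h.integral_memLp ⟨t, t.2.1⟩ t.2.2).toLp) atTop := by
    rw [EMetric.tendstoUniformly_iff]
    intro ε hε
    filter_upwards [hS.eventually (gt_mem_nhds hε)] with l hl t
    refine lt_of_le_of_lt ?_ hl
    rw [edist_comm, Lp.edist_toLp_toLp]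
    exact (((S l).isItoIntegral hW T).eLpNorm_sub_le hW h (t := ⟨t, t.2.1⟩) t.2.2).trans
      (eLpNorm_mono_measure _ (timeMeasure_prod_mono P t.2.2))
  exact hu.continuous (.of_forall fun l => ((S l).continuous_toLp hW).comp (by fun_prop))

/-- By the isometry the elementary integrals are Cauchy in `L²(Ω)`. The limit is chosen separately
at each time, with no path regularity. -/
theorem exists_isItoIntegral {Ω : Type*} {mΩ : MeasurableSpace Ω} {P : Measure Ω}
    [IsProbabilityMeasure P] {𝓕 : Filtration ℝ≥0 mΩ} {W : ℝ≥0 → Ω → ℝ} {T : ℝ} {H : ℝ → Ω → ℝ}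
    (hW : IsBrownianMotionFor P 𝓕 W)
    (hH : MemLp (fun p : ℝ × Ω => H p.1 p.2) 2 ((timeMeasure T).prod P))
    {S : ℕ → SimpleProcess P 𝓕} (hS : Tendsto (fun l => eLpNorm (fun p : ℝ × Ω =>
      (S l).eval p.1 p.2 - H p.1 p.2) 2 ((timeMeasure T).prod P)) atTop (𝓝 0)) :
    ∃ I : ℝ≥0 → Ω → ℝ, IsItoIntegral P 𝓕 W T H I := by
  have key : ∀ t : ℝ≥0, ∃ g : Lp ℝ 2 P, (t : ℝ) ≤ T →
      Tendsto (fun l => ((S l).memLp_integral hW t).toLp) atTop (𝓝 g) := by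
    intro t
    by_cases ht : (t : ℝ) ≤ T
    swap
    · exact ⟨0, fun h => absurd h ht⟩
    have hμ := timeMeasure_prod_mono P ht
    have hc : CauchySeq (fun l => ((S l).memLp_integral hW t).toLp) := by
      rw [EMetric.cauchySeq_iff]
      intro ε hε
      obtain ⟨N, hN⟩ := eventually_atTop.1 (hS.eventually (gt_mem_nhds (ENNReal.half_pos hε.ne')))
      refine ⟨N, fun m hm n hn => ?_⟩
      have mH := hH.aestronglyMeasurable
      have e : (fun p : ℝ × Ω => (S m).eval p.1 p.2 - (S n).eval p.1 p.2) =
          (fun p : ℝ × Ω => (S m).eval p.1 p.2 - H p.1 p.2) -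
          (fun p : ℝ × Ω => (S n).eval p.1 p.2 - H p.1 p.2) := by
        ext p; simp
      rw [Lp.edist_toLp_toLp, ← ENNReal.add_halves ε]
      refine lt_of_le_of_lt ?_ (ENNReal.add_lt_add (hN m hm) (hN n hn))
      refine (SimpleProcess.eLpNorm_integral_sub hW (S m) (S n) t).trans_le ?_
      refine (eLpNorm_mono_measure _ hμ).trans ?_
      rw [e]
      exact eLpNorm_sub_le (((S m).memLp_eval T).aestronglyMeasurable.sub mH)
        (((S n).memLp_eval T).aestronglyMeasurable.sub mH) (by norm_num)
    obtain ⟨g, hg⟩ := cauchySeq_tendsto_of_complete hc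
    exact ⟨g, fun _ => hg⟩
  choose I hI using key
  refine ⟨fun t => I t, hH, fun t _ => Lp.memLp (I t), S, hS, fun t ht => ?_⟩
  have := hI t ht
  rw [← Lp.toLp_coeFn (I t) (Lp.memLp _)] at this
  exact (Lp.tendsto_Lp_iff_tendsto_eLpNorm'' _ (fun l => (S l).memLp_integral hW t) _
    (Lp.memLp (I t))).1 this

/-! ### Processes representing curves in `L²(Ω)` -/

section Realization

variable {Ω : Type*} {mΩ : MeasurableSpace Ω} {P : Measure Ω} {𝓕 : Filtration ℝ≥0 mΩ} {T : ℝ}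

theorem MeasureTheory.eLpNorm_two_sq {α : Type*} {m : MeasurableSpace α} (μ : Measure α)
    (f : α → ℝ) : eLpNorm f 2 μ ^ 2 = ∫⁻ x, ‖f x‖ₑ ^ 2 ∂μ := by
  have := eLpNorm_nnreal_pow_eq_lintegral (μ := μ) (f := f) (p := 2) (by norm_num)
  simp only [NNReal.coe_ofNat, ENNReal.coe_ofNat, ENNReal.rpow_ofNat] at this
  exact this

theorem MeasureTheory.eLpNorm_two_sq_prod {α : Type*} {m : MeasurableSpace α} {μ : Measure α}
    [SFinite μ] [SFinite P] {f : α → Ω → ℝ}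
    (hf : AEStronglyMeasurable (fun p : α × Ω => f p.1 p.2) (μ.prod P)) :
    eLpNorm (fun p : α × Ω => f p.1 p.2) 2 (μ.prod P) ^ 2 = ∫⁻ t, eLpNorm (f t) 2 P ^ 2 ∂μ := by
  simp_rw [eLpNorm_two_sq]
  exact lintegral_prod _ (hf.enorm.pow_const 2)

theorem MeasureTheory.eLpNorm_two_prod_le {α : Type*} {m : MeasurableSpace α} {μ : Measure α}
    [SFinite μ] [SFinite P] {f : α → Ω → ℝ}
    (hf : AEStronglyMeasurable (fun p : α × Ω => f p.1 p.2) (μ.prod P)) {C : ℝ≥0∞}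
    (hC : ∀ᵐ t ∂μ, eLpNorm (f t) 2 P ≤ C) :
    eLpNorm (fun p : α × Ω => f p.1 p.2) 2 (μ.prod P) ≤ C * μ Set.univ ^ (1 / 2 : ℝ) := by
  have h : eLpNorm (fun p : α × Ω => f p.1 p.2) 2 (μ.prod P) ^ 2 ≤
      (C * μ Set.univ ^ (1 / 2 : ℝ)) ^ 2 := by
    rw [eLpNorm_two_sq_prod hf, mul_pow, ← ENNReal.rpow_natCast (μ Set.univ ^ _),
      ← ENNReal.rpow_mul]
    norm_num
    rw [← lintegral_const]
    exact lintegral_mono_ae (hC.mono fun t ht => pow_le_pow_left' ht 2)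
  exact (ENNReal.pow_le_pow_left_iff two_ne_zero).1 h

/-- The curve `X` in `L²(Ω)` is adapted. -/
def IsAdaptedCurve (P : Measure Ω) (𝓕 : Filtration ℝ≥0 mΩ) (X : Set.Icc 0 T → Lp ℝ 2 P) : Prop :=
  ∀ t : Set.Icc 0 T, X t ∈ lpMeas ℝ ℝ (𝓕 ⟨t, t.2.1⟩) 2 P

/-- `y` is an adapted and jointly measurable process representing the curve `X` in `L²(Ω)`. -/
structure IsRealization (𝓕 : Filtration ℝ≥0 mΩ) (X : Set.Icc 0 T → Lp ℝ 2 P)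
    (y : ℝ → Ω → ℝ) : Prop where
  measurable : Measurable (fun p : ℝ × Ω => y p.1 p.2)
  adapted : ∀ t : ℝ≥0, (t : ℝ) ≤ T → StronglyMeasurable[𝓕 t] (y t)
  ae_eq : ∀ t : Set.Icc 0 T, y t =ᵐ[P] X t

/-- The squared errors have summable integrals, so their sum is finite a.e. and its terms tend to
zero. -/
theorem ae_tendsto_of_eLpNorm_le_geometric {x : ℕ → Ω → ℝ} {g : Ω → ℝ}
    (hx : ∀ n, AEStronglyMeasurable (x n) P) (hg : AEStronglyMeasurable g P)
    (h : ∀ n, eLpNorm (x n - g) 2 P ≤ ENNReal.ofReal ((1 / 2) ^ n)) :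
    ∀ᵐ ω ∂P, Tendsto (fun n => x n ω) atTop (𝓝 (g ω)) := by
  have hm : ∀ n, AEMeasurable (fun ω => ‖(x n - g) ω‖ₑ ^ 2) P := fun n =>
    ((hx n).sub hg).enorm.pow_const 2
  have hfin : ∫⁻ ω, ∑' n, ‖(x n - g) ω‖ₑ ^ 2 ∂P ≠ ∞ := by
    rw [lintegral_tsum hm]
    simp_rw [← eLpNorm_two_sq]
    have hs : Summable (fun n : ℕ => ((1 / 2 : ℝ) ^ n) ^ 2) := by
      simp_rw [← pow_mul, mul_comm _ 2, pow_mul]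
      exact summable_geometric_of_lt_one (by norm_num) (by norm_num)
    refine ne_top_of_le_ne_top hs.tsum_ofReal_ne_top (ENNReal.tsum_le_tsum fun n => ?_)
    rw [ENNReal.ofReal_pow (by positivity)]
    exact pow_le_pow_left' (h n) 2
  filter_upwards [ae_lt_top' (AEMeasurable.tsum hm) hfin] with ω hω
  have h0 := ENNReal.tendsto_atTop_zero_of_tsum_ne_top hω.ne
  rw [tendsto_iff_edist_tendsto_0]
  have h1 := (ENNReal.continuous_rpow_const (y := 1 / 2)).tendsto 0 |>.comp h0
  simp only [Function.comp_def, ← ENNReal.rpow_natCast, ← ENNReal.rpow_mul] at h1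
  simpa [edist_eq_enorm_sub] using h1

/-- Sample the curve at grid points to the left of `t`: the samples are piecewise constant in `t`,
hence jointly measurable, and adapted because they look only backwards. Grids with error at most
`2⁻ⁿ`, available by uniform continuity, give a.e. convergence at every fixed `t`. -/
theorem exists_isRealization (X : C(Set.Icc 0 T, Lp ℝ 2 P)) (hX : IsAdaptedCurve P 𝓕 X) :
    ∃ y : ℝ → Ω → ℝ, IsRealization 𝓕 X y := by
  have hr : ∀ t : ℝ≥0, ∃ r : Ω → ℝ, StronglyMeasurable[𝓕 t] r ∧
      ∀ ht : (t : ℝ) ≤ T, r =ᵐ[P] X ⟨t, t.2, ht⟩ := by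
    intro t
    by_cases ht : (t : ℝ) ≤ T
    · obtain ⟨r, hr, he⟩ := mem_lpMeas_iff_aestronglyMeasurable.1 (hX ⟨t, t.2, ht⟩)
      exact ⟨r, hr, fun _ => he.symm⟩
    · exact ⟨0, stronglyMeasurable_zero, fun h => absurd h ht⟩
  choose r hrm hre using hr
  have hδ : ∀ n : ℕ, ∃ δ : ℝ≥0, 0 < δ ∧ ∀ s t : Set.Icc 0 T, dist s t ≤ δ →
      dist (X s) (X t) ≤ (1 / 2) ^ n := by
    intro n
    obtain ⟨δ, hδ, h⟩ := Metric.uniformContinuous_iff.1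
      (CompactSpace.uniformContinuous_of_continuous X.continuous) ((1 / 2) ^ n) (by positivity)
    refine ⟨⟨δ / 2, by positivity⟩, by exact_mod_cast half_pos hδ, fun s t hst => (h ?_).le⟩
    exact hst.trans_lt (half_lt_self hδ)
  choose δ hδ0 hδ using hδ
  let x : ℕ → ℝ → Ω → ℝ := fun n t => r (δ n * ⌊t / δ n⌋₊)
  have hle : ∀ n (t : ℝ), 0 ≤ t → ((δ n * ⌊t / δ n⌋₊ : ℝ≥0) : ℝ) ≤ t ∧
      t - ((δ n * ⌊t / δ n⌋₊ : ℝ≥0) : ℝ) ≤ δ n := by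
    intro n t ht
    have h0 : (0 : ℝ) < δ n := NNReal.coe_pos.2 (hδ0 n)
    have h1 := Nat.floor_le (div_nonneg ht h0.le)
    have h2 := (Nat.lt_floor_add_one (t / δ n)).le
    rw [le_div_iff₀ h0] at h1
    rw [div_le_iff₀ h0] at h2
    push_cast
    constructor <;> linarith
  -- The `limsup` is measurable even where the samples diverge, so no null set has to be removed and
  -- `𝓕` need not be complete.
  refine ⟨fun t ω => limsup (fun n => x n t ω) atTop, ?_, fun t ht => ?_, fun t => ?_⟩
  · refine Measurable.limsup fun n => ?_
    have h1 : Measurable (fun p : ℕ × Ω => r (δ n * p.1) p.2) :=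
      measurable_from_prod_countable_right fun k => ((hrm (δ n * k)).mono (𝓕.le _)).measurable
    exact h1.comp (((Nat.measurable_floor.comp (measurable_id.div_const _)).comp
      measurable_fst).prodMk measurable_snd)
  · refine Measurable.stronglyMeasurable ?_
    refine Measurable.limsup fun n => ?_
    exact ((hrm _).mono (𝓕.mono (NNReal.coe_le_coe.1 (hle n t t.2).1))).measurable
  · have hx : ∀ n, x n t =ᵐ[P] X ⟨(δ n * ⌊(t : ℝ) / δ n⌋₊ : ℝ≥0), by positivity,
        (hle n t t.2.1).1.trans t.2.2⟩ := fun n =>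
      hre _ ((hle n t t.2.1).1.trans t.2.2)
    have := ae_tendsto_of_eLpNorm_le_geometric (P := P) (x := fun n => x n t) (g := X t)
      (fun n => (Lp.aestronglyMeasurable _).congr (hx n).symm)
      (Lp.aestronglyMeasurable _) fun n => ?_
    · filter_upwards [this] with ω hω using hω.limsup_eq
    · rw [eLpNorm_congr_ae ((hx n).sub .rfl), ← Lp.edist_def, edist_dist]
      refine ENNReal.ofReal_le_ofReal (hδ n _ _ ?_)
      rw [Subtype.dist_eq, Real.dist_eq, abs_sub_comm, abs_of_nonneg]
      · exact (hle n t t.2.1).2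
      · exact sub_nonneg.2 (hle n t t.2.1).1

namespace IsRealization

variable {X X' : C(Set.Icc 0 T, Lp ℝ 2 P)} {y y' : ℝ → Ω → ℝ}

theorem memLp_apply (h : IsRealization 𝓕 X y) (t : Set.Icc 0 T) : MemLp (y t) 2 P :=
  (memLp_congr_ae (h.ae_eq t)).2 (Lp.memLp _)

theorem eLpNorm_sub (h : IsRealization 𝓕 X y) (h' : IsRealization 𝓕 X' y') (s t : Set.Icc 0 T) :
    eLpNorm (fun ω => y s ω - y' t ω) 2 P = ENNReal.ofReal (dist (X s) (X' t)) := by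
  rw [← edist_dist, Lp.edist_def]
  exact eLpNorm_congr_ae ((h.ae_eq s).sub (h'.ae_eq t))

theorem memLp [SFinite P] (h : IsRealization 𝓕 X y) :
    MemLp (fun p : ℝ × Ω => y p.1 p.2) 2 ((timeMeasure T).prod P) := by
  have hm : AEStronglyMeasurable (fun p : ℝ × Ω => y p.1 p.2) ((timeMeasure T).prod P) :=
    h.measurable.aestronglyMeasurable
  refine ⟨hm, (eLpNorm_two_prod_le hm (C := ENNReal.ofReal ‖X‖) ?_).trans_lt ?_⟩
  · filter_upwards [ae_restrict_mem measurableSet_Icc] with t ht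
    rw [eLpNorm_congr_ae (h.ae_eq ⟨t, ht⟩), ← Lp.enorm_def, ← ofReal_norm]
    exact ENNReal.ofReal_le_ofReal (X.norm_coe_le_norm _)
  · refine ENNReal.mul_lt_top ENNReal.ofReal_lt_top (ENNReal.rpow_lt_top_of_nonneg (by norm_num) ?_)
    simp

end IsRealization

end Realization

/-- Lipschitz continuity of a function of two real variables. -/
def IsLipschitzPair (C : ℝ) (σ : ℝ → ℝ → ℝ) : Prop :=
  ∀ y u y' u' : ℝ, |σ y u - σ y' u'| ≤ C * (|y - y'| + |u - u'|)

namespace IsLipschitzPair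

variable {C : ℝ} {σ : ℝ → ℝ → ℝ} {α : Type*} {m : MeasurableSpace α} {μ : Measure α}

theorem continuous (h : IsLipschitzPair C σ) : Continuous (fun p : ℝ × ℝ => σ p.1 p.2) := by
  rw [continuous_iff_continuousAt]
  intro p
  rw [ContinuousAt, tendsto_iff_dist_tendsto_zero]
  have h0 : Continuous (fun q : ℝ × ℝ => C * (|q.1 - p.1| + |q.2 - p.2|)) := by fun_prop
  refine squeeze_zero (fun _ => dist_nonneg) (fun q => h q.1 q.2 p.1 p.2) ?_
  simpa using h0.tendsto p

theorem aestronglyMeasurable (h : IsLipschitzPair C σ) {f g : α → ℝ}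
    (hf : AEStronglyMeasurable f μ) (hg : AEStronglyMeasurable g μ) :
    AEStronglyMeasurable (fun x => σ (f x) (g x)) μ :=
  h.continuous.comp_aestronglyMeasurable (hf.prodMk hg)

theorem memLp [IsFiniteMeasure μ] (h : IsLipschitzPair C σ) {f g : α → ℝ}
    (hf : MemLp f 2 μ) (hg : MemLp g 2 μ) : MemLp (fun x => σ (f x) (g x)) 2 μ := by
  refine MemLp.of_le ((memLp_const |σ 0 0|).add ((hf.norm.add hg.norm).const_mul C))
    (h.aestronglyMeasurable hf.aestronglyMeasurable hg.aestronglyMeasurable) (.of_forall fun x => ?_)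
  have h1 := h (f x) (g x) 0 0
  have h2 := abs_add_le (σ (f x) (g x) - σ 0 0) (σ 0 0)
  simp only [sub_zero, sub_add_cancel] at h1 h2
  refine le_trans ?_ (le_abs_self _)
  simp only [Pi.add_apply, Real.norm_eq_abs]
  linarith

theorem eLpNorm_sub_le (h : IsLipschitzPair C σ) {f g f' g' : α → ℝ}
    (hf : AEStronglyMeasurable f μ) (hg : AEStronglyMeasurable g μ)
    (hf' : AEStronglyMeasurable f' μ) (hg' : AEStronglyMeasurable g' μ) :
    eLpNorm (fun x => σ (f x) (g x) - σ (f' x) (g' x)) 2 μ ≤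
      ENNReal.ofReal C * (eLpNorm (fun x => f x - f' x) 2 μ +
        eLpNorm (fun x => g x - g' x) 2 μ) := by
  refine (eLpNorm_le_mul_eLpNorm_of_ae_le_mul (c := C) (g := fun x => |f x - f' x| + |g x - g' x|)
    (.of_forall fun x => ?_) 2).trans ?_
  · rw [Real.norm_eq_abs, Real.norm_of_nonneg (add_nonneg (abs_nonneg _) (abs_nonneg _))]
    exact h _ _ _ _
  · gcongr
    refine (eLpNorm_add_le (hf.sub hf').norm (hg.sub hg').norm (by norm_num)).trans_eq ?_
    exact congrArg₂ _ (eLpNorm_norm (f := fun x => f x - f' x))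
      (eLpNorm_norm (f := fun x => g x - g' x))

end IsLipschitzPair

/-! ### Simple approximations of `σ(y, u)` -/

section Approximation

variable {Ω : Type*} {mΩ : MeasurableSpace Ω} {P : Measure Ω} {𝓕 : Filtration ℝ≥0 mΩ} {T : ℝ}

/-- `K` is frozen at the left end of each mesh interval, which keeps the coefficients adapted. Time
`0` is excluded because every left-open interval misses it. -/
theorem exists_simpleProcess_mesh (hT : 0 ≤ T) {K : ℝ → Ω → ℝ}
    (hK : ∀ t : ℝ≥0, (t : ℝ) ≤ T → StronglyMeasurable[𝓕 t] (K t))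
    (hK2 : ∀ t : Set.Icc 0 T, MemLp (K t) 2 P) {δ : ℝ} (hδ : 0 < δ) :
    ∃ S : SimpleProcess P 𝓕, ∀ t ∈ Set.Ioc 0 T, ∃ s : Set.Icc 0 T, |t - s| ≤ δ ∧
      S.eval t = K s := by
  lift δ to ℝ≥0 using hδ.le
  lift T to ℝ≥0 using hT
  have hτ : ∀ k : ℕ, ((min (k * δ) T : ℝ≥0) : ℝ) ≤ T := fun k =>
    NNReal.coe_le_coe.2 (min_le_right _ _)
  have hmono : Monotone (fun k : ℕ => min (k * δ) T) := fun j k hjk => by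
    have : (j : ℝ≥0) ≤ k := Nat.cast_le.2 hjk
    dsimp only
    gcongr
  let S : SimpleProcess P 𝓕 :=
    { n := ⌈(T : ℝ) / δ⌉₊
      τ := fun k => min (k * δ) T
      ξ := fun k => K (min (k * δ) T : ℝ≥0)
      mono := hmono
      meas := fun k => hK _ (hτ k)
      memLp := fun k => hK2 ⟨_, NNReal.coe_nonneg _, hτ k⟩ }
  refine ⟨S, fun t ht => ?_⟩
  have hpos : 0 < t / (δ : ℝ) := div_pos ht.1 hδ
  -- The intervals are `(kδ, (k+1)δ]`, so the index of the one containing `t` is the ceiling minus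
  -- one, not the floor.
  obtain ⟨k, hk⟩ : ∃ k, ⌈t / (δ : ℝ)⌉₊ = k + 1 :=
    Nat.exists_eq_succ_of_ne_zero (Nat.ceil_pos.2 hpos).ne'
  have h1 : (k : ℝ) * δ < t := by
    rw [← lt_div_iff₀ hδ]
    exact Nat.lt_ceil.1 (by omega)
  have h2 : t ≤ ((k : ℝ) + 1) * δ := by
    rw [← div_le_iff₀ hδ]
    have := Nat.le_ceil (t / (δ : ℝ))
    rw [hk] at this
    exact_mod_cast this
  have hτk : ((min (k * δ) T : ℝ≥0) : ℝ) = k * δ := by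
    push_cast
    exact min_eq_left (h1.le.trans ht.2)
  have hmem : t ∈ Set.Ioc ((min (k * δ) T : ℝ≥0) : ℝ) ((min ((k + 1 : ℕ) * δ) T : ℝ≥0) : ℝ) := by
    refine ⟨hτk ▸ h1, ?_⟩
    push_cast
    exact le_min h2 ht.2
  refine ⟨⟨(min (k * δ) T : ℝ≥0), NNReal.coe_nonneg _, hτ k⟩, ?_, ?_⟩
  · change |t - ((min (k * δ) T : ℝ≥0) : ℝ)| ≤ δ
    rw [hτk, abs_of_nonneg (by linarith)]
    linarith
  · ext ω
    have hkn : k ∈ Finset.range S.n := by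
      refine Finset.mem_range.2 (Nat.lt_ceil.2 ?_)
      rw [lt_div_iff₀ hδ]
      exact h1.trans_le ht.2
    unfold SimpleProcess.eval
    rw [Finset.sum_eq_single_of_mem k hkn]
    · exact Set.indicator_of_mem hmem _
    · intro j _ hjk
      refine Set.indicator_of_notMem (fun hj => ?_) _
      rcases lt_or_gt_of_ne hjk with h | h
      · have := NNReal.coe_le_coe.2 (hmono (Nat.succ_le_of_lt h))
        exact absurd (hj.2.trans this) (not_le.2 hmem.1)
      · have := NNReal.coe_le_coe.2 (hmono (Nat.succ_le_of_lt h))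
        exact absurd (hmem.2.trans this) (not_le.2 hj.1)

theorem ae_timeMeasure_mem_Ioc (T : ℝ) : ∀ᵐ t ∂(timeMeasure T), t ∈ Set.Ioc 0 T := by
  have h : ∀ᵐ t : ℝ ∂(timeMeasure T), t ≠ 0 := ae_restrict_of_ae (Measure.ae_ne volume 0)
  filter_upwards [ae_restrict_mem measurableSet_Icc, h] with t ht h0
  exact ⟨lt_of_le_of_ne ht.1 (Ne.symm h0), ht.2⟩

variable [IsProbabilityMeasure P]

theorem eLpNorm_comp_fst (T : ℝ) {g : ℝ → ℝ} (hg : AEStronglyMeasurable g (timeMeasure T)) :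
    eLpNorm (fun p : ℝ × Ω => g p.1) 2 ((timeMeasure T).prod P) =
      eLpNorm g 2 (timeMeasure T) :=
  eLpNorm_comp_measurePreserving hg measurePreserving_fst

/-- A control in `L²` cannot be frozen in time, so it is first replaced by a continuous `g` close to
it; `σ(y, g)` is then uniformly continuous from `[0, T]` into `L²(Ω)`. The three `ε` come from the
modulus of `X`, the modulus of `g`, and `u - g`. -/
theorem IsRealization.exists_simpleProcess_le (hT : 0 ≤ T) {X : C(Set.Icc 0 T, Lp ℝ 2 P)}
    {y : ℝ → Ω → ℝ} (hy : IsRealization 𝓕 X y) {C : ℝ} {σ : ℝ → ℝ → ℝ}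
    (hσ : IsLipschitzPair C σ) {u : ℝ → ℝ} (hu : MemLp u 2 (timeMeasure T)) {ε : ℝ} (hε : 0 < ε) :
    ∃ S : SimpleProcess P 𝓕,
      eLpNorm (fun p : ℝ × Ω => S.eval p.1 p.2 - σ (y p.1 p.2) (u p.1)) 2
        ((timeMeasure T).prod P) ≤ ENNReal.ofReal C *
        (ENNReal.ofReal ε + ENNReal.ofReal ε) * timeMeasure T Set.univ ^ (1 / 2 : ℝ) +
        ENNReal.ofReal C * ENNReal.ofReal ε := by
  obtain ⟨g, hg, hg2⟩ := hu.exists_boundedContinuous_eLpNorm_sub_le (by simp)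
    (ENNReal.ofReal_pos.2 hε).ne'
  obtain ⟨δ₁, hδ₁, h₁⟩ := Metric.uniformContinuous_iff.1
      (CompactSpace.uniformContinuous_of_continuous X.continuous) ε hε
  obtain ⟨δ₂, hδ₂, h₂⟩ := Metric.uniformContinuous_iff.1
      (CompactSpace.uniformContinuous_of_continuous
        (g.continuous.comp (continuous_subtype_val : Continuous (Subtype.val : Set.Icc 0 T → ℝ)))) ε hε
  have hδ : 0 < min δ₁ δ₂ / 2 := half_pos (lt_min hδ₁ hδ₂)
  have hK2 : ∀ t : Set.Icc 0 T, MemLp (fun ω => σ (y t ω) (g t)) 2 P := fun t =>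
    hσ.memLp (hy.memLp_apply t) (memLp_const _)
  obtain ⟨S, hS⟩ := exists_simpleProcess_mesh (𝓕 := 𝓕) hT (K := fun t ω => σ (y t ω) (g t))
    (fun t ht => hσ.continuous.comp_stronglyMeasurable
      ((hy.adapted t ht).prodMk stronglyMeasurable_const)) hK2 hδ
  have my := hy.memLp.aestronglyMeasurable
  have mS := (S.memLp_eval T).aestronglyMeasurable
  have mg : AEStronglyMeasurable (fun p : ℝ × Ω => g p.1) ((timeMeasure T).prod P) :=
    hg2.aestronglyMeasurable.comp_fst
  have mu : AEStronglyMeasurable (fun p : ℝ × Ω => u p.1) ((timeMeasure T).prod P) :=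
    hu.aestronglyMeasurable.comp_fst
  refine ⟨S, ?_⟩
  have e : (fun p : ℝ × Ω => S.eval p.1 p.2 - σ (y p.1 p.2) (u p.1)) =
      (fun p : ℝ × Ω => S.eval p.1 p.2 - σ (y p.1 p.2) (g p.1)) +
      (fun p : ℝ × Ω => σ (y p.1 p.2) (g p.1) - σ (y p.1 p.2) (u p.1)) := by
    ext p; simp
  rw [e]
  refine (eLpNorm_add_le (mS.sub (hσ.aestronglyMeasurable my mg))
    ((hσ.aestronglyMeasurable my mg).sub (hσ.aestronglyMeasurable my mu)) (by norm_num)).trans ?_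
  refine add_le_add ?_ ?_
  · refine eLpNorm_two_prod_le (f := fun t ω => S.eval t ω - σ (y t ω) (g t))
      (mS.sub (hσ.aestronglyMeasurable my mg)) ?_
    filter_upwards [ae_timeMeasure_mem_Ioc T] with t ht
    obtain ⟨s, hts, hs⟩ := hS t ht
    have ht' : t ∈ Set.Icc 0 T := Set.Ioc_subset_Icc_self ht
    have hlt : dist s (⟨t, ht'⟩ : Set.Icc 0 T) < min δ₁ δ₂ := by
      rw [dist_comm, Subtype.dist_eq, Real.dist_eq]
      exact hts.trans_lt (half_lt_self (lt_min hδ₁ hδ₂))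
    rw [hs]
    refine (hσ.eLpNorm_sub_le (hy.memLp_apply s).aestronglyMeasurable
      aestronglyMeasurable_const (hy.memLp_apply ⟨t, ht'⟩).aestronglyMeasurable
      aestronglyMeasurable_const).trans ?_
    gcongr
    · rw [hy.eLpNorm_sub hy s ⟨t, ht'⟩]
      exact ENNReal.ofReal_le_ofReal (h₁ (hlt.trans_le (min_le_left _ _))).le
    · rw [eLpNorm_const _ (by norm_num) (IsProbabilityMeasure.ne_zero P)]
      simp only [measure_univ, ENNReal.one_rpow, mul_one]
      rw [← ofReal_norm]
      exact ENNReal.ofReal_le_ofReal (h₂ (hlt.trans_le (min_le_right _ _))).le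
  · refine (hσ.eLpNorm_sub_le my mg my mu).trans ?_
    gcongr
    simp only [sub_self]
    rw [eLpNorm_comp_fst (P := P) T (g := fun t => g t - u t)
      (hg2.aestronglyMeasurable.sub hu.aestronglyMeasurable), eLpNorm_zero', zero_add]
    rw [← eLpNorm_neg]
    refine le_trans (le_of_eq ?_) hg
    congr 1
    ext t
    simp

theorem IsRealization.exists_isItoIntegral {W : ℝ≥0 → Ω → ℝ} (hW : IsBrownianMotionFor P 𝓕 W)
    (hT : 0 ≤ T) {X : C(Set.Icc 0 T, Lp ℝ 2 P)}
    {y : ℝ → Ω → ℝ} (hy : IsRealization 𝓕 X y) {C : ℝ} {σ : ℝ → ℝ → ℝ}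
    (hσ : IsLipschitzPair C σ) {u : ℝ → ℝ} (hu : MemLp u 2 (timeMeasure T)) :
    ∃ I : ℝ≥0 → Ω → ℝ, IsItoIntegral P 𝓕 W T (fun t ω => σ (y t ω) (u t)) I := by
  choose S hS using fun n : ℕ => hy.exists_simpleProcess_le hT hσ hu
    (Nat.one_div_pos_of_nat (α := ℝ) (n := n))
  refine _root_.exists_isItoIntegral (S := S) hW (hσ.memLp hy.memLp (hu.comp_fst P)) ?_
  refine tendsto_of_tendsto_of_tendsto_of_le_of_le tendsto_const_nhds ?_
    (fun _ => zero_le) hS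
  have h0 : Tendsto (fun n : ℕ => ENNReal.ofReal (1 / ((n : ℝ) + 1))) atTop (𝓝 0) := by
    simpa [Function.comp_def] using (ENNReal.continuous_ofReal.tendsto 0).comp tendsto_one_div_add_atTop_nhds_zero_nat
  have hc : timeMeasure T Set.univ ^ (1 / 2 : ℝ) ≠ ∞ :=
    (ENNReal.rpow_lt_top_of_nonneg (by norm_num) (by simp)).ne
  have h1 := ((ENNReal.Tendsto.mul_const (ENNReal.Tendsto.const_mul (a := ENNReal.ofReal C)
    (h0.add h0) (.inr ENNReal.ofReal_ne_top)) (.inr hc)).add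
    (ENNReal.Tendsto.const_mul (a := ENNReal.ofReal C) h0 (.inr ENNReal.ofReal_ne_top)))
  simpa using h1

end Approximation

/-! ### Weighted fixed points -/

theorem Submodule.integral_mem_of_isComplete {α E : Type*} {m : MeasurableSpace α}
    {μ : Measure α} [NormedAddCommGroup E] [InnerProductSpace ℝ E] [CompleteSpace E]
    (V : Submodule ℝ E) [CompleteSpace V] {f : α → E} (hf : Integrable f μ)
    (h : ∀ᵐ x ∂μ, f x ∈ V) : ∫ x, f x ∂μ ∈ V := by
  rw [← Submodule.starProjection_eq_self_iff, ← ContinuousLinearMap.integral_comp_comm _ hf]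
  refine integral_congr_ae ?_
  filter_upwards [h] with x hx using Submodule.starProjection_eq_self_iff.2 hx

/-- Substituting `X = exp (r t) Z` turns the weighted bound into a contraction by `1/2` in the sup
norm. Stability of `A` under continuous scalar factors keeps the conjugated map inside `A`. -/
theorem exists_isFixedPt_of_exp_bound {E : Type*} [NormedAddCommGroup E] [NormedSpace ℝ E]
    [CompleteSpace E] {T : ℝ} {A : Set C(Set.Icc 0 T, E)} (hA : IsClosed A) (hne : A.Nonempty)
    (hsmul : ∀ X ∈ A, ∀ c : C(Set.Icc 0 T, ℝ), c • X ∈ A)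
    {Φ : C(Set.Icc 0 T, E) → C(Set.Icc 0 T, E)} (hΦ : Set.MapsTo Φ A A) {r : ℝ}
    (h : ∀ X ∈ A, ∀ Y ∈ A, ∀ M : ℝ, 0 ≤ M → (∀ s, ‖X s - Y s‖ ≤ M * Real.exp (r * s)) →
      ∀ t, ‖Φ X t - Φ Y t‖ ≤ 1 / 2 * (M * Real.exp (r * t))) : ∃ X ∈ A, Φ X = X := by
  let c : C(Set.Icc 0 T, ℝ) := ⟨fun t => Real.exp (r * t), by fun_prop⟩
  let d : C(Set.Icc 0 T, ℝ) := ⟨fun t => Real.exp (-(r * t)), by fun_prop⟩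
  have hcd : ∀ t, c t * d t = 1 := fun t => by
    change Real.exp (r * t) * Real.exp (-(r * t)) = 1
    rw [← Real.exp_add, add_neg_cancel, Real.exp_zero]
  have hpos : ∀ t, 0 < d t := fun t => Real.exp_pos _
  let Ψ : A → A := fun Z => ⟨d • Φ (c • Z.1), hsmul _ (hΦ (hsmul _ Z.2 c)) d⟩
  have : CompleteSpace A := hA.completeSpace_coe
  have : Nonempty A := hne.to_subtype
  have hΨ : ContractingWith (1 / 2) Ψ := by
    refine ⟨by rw [← NNReal.coe_lt_coe]; norm_num, LipschitzWith.of_dist_le_mul fun Z Z' => ?_⟩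
    rw [Subtype.dist_eq, ContinuousMap.dist_le (by positivity)]
    intro t
    have key := h _ (hsmul _ Z.2 c) _ (hsmul _ Z'.2 c) (dist Z Z') dist_nonneg (fun s => ?_) t
    · change dist (d t • Φ (c • Z.1) t) (d t • Φ (c • Z'.1) t) ≤ _
      rw [dist_smul₀, Real.norm_of_nonneg (hpos t).le, dist_eq_norm]
      refine (mul_le_mul_of_nonneg_left key (hpos t).le).trans_eq ?_
      have := hcd t
      change Real.exp (r * t) * d t = 1 at this
      push_cast
      linear_combination (1 / 2 * dist Z Z') * this
    · change ‖c s • Z.1 s - c s • Z'.1 s‖ ≤ dist Z Z' * c s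
      rw [← smul_sub, norm_smul, Real.norm_of_nonneg (show 0 ≤ c s from (Real.exp_pos _).le),
        mul_comm, ← dist_eq_norm]
      exact mul_le_mul_of_nonneg_right (ContinuousMap.dist_apply_le_dist s) (Real.exp_pos _).le
  refine ⟨c • (hΨ.fixedPoint Ψ).1, hsmul _ (hΨ.fixedPoint Ψ).2 c, ?_⟩
  have hfix : d • Φ (c • (hΨ.fixedPoint Ψ).1) = (hΨ.fixedPoint Ψ).1 :=
    congrArg Subtype.val hΨ.fixedPoint_isFixedPt
  conv_rhs => rw [← hfix]
  ext1 t
  change _ = c t • d t • Φ (c • (hΨ.fixedPoint Ψ).1) t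
  rw [smul_smul, hcd, one_smul]

theorem integral_exp_mul_le {c t : ℝ} (hc : 0 < c) :
    ∫ s in (0 : ℝ)..t, Real.exp (c * s) ≤ Real.exp (c * t) / c := by
  rw [intervalIntegral.integral_comp_mul_left _ hc.ne', integral_exp, smul_eq_mul, mul_zero,
    Real.exp_zero, div_eq_inv_mul]
  have := inv_pos.2 hc
  nlinarith

theorem uIcc_subset_of_mem_Icc {T t : ℝ} (ht : t ∈ Set.Icc 0 T) :
    Set.uIcc 0 t ⊆ Set.uIcc 0 T := by
  rw [Set.uIcc_of_le ht.1, Set.uIcc_of_le (ht.1.trans ht.2)]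
  exact Set.Icc_subset_Icc_right ht.2

/-! ### The drift as an integral in `L²(Ω)` -/

section Drift

variable {Ω : Type*} {mΩ : MeasurableSpace Ω} {P : Measure Ω} {𝓕 : Filtration ℝ≥0 mΩ} {T : ℝ}

theorem intervalIntegrable_of_integrable_timeMeasure {E : Type*} [NormedAddCommGroup E]
    {f : ℝ → E} (hT : 0 ≤ T) (hf : Integrable f (timeMeasure T)) :
    IntervalIntegrable f volume 0 T :=
  (intervalIntegrable_iff_integrableOn_Icc_of_le hT).2 hf

theorem intervalIntegrable_smul_curve {a : ℝ → ℝ} (hT : 0 ≤ T) (ha : Integrable a (timeMeasure T))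
    (X : C(Set.Icc 0 T, Lp ℝ 2 P)) :
    IntervalIntegrable (fun s => a s • X (Set.projIcc 0 T hT s)) volume 0 T :=
  (intervalIntegrable_of_integrable_timeMeasure hT ha).smul_continuousOn
    (X.continuous.comp continuous_projIcc).continuousOn

theorem continuous_drift {a : ℝ → ℝ} (hT : 0 ≤ T) (ha : Integrable a (timeMeasure T))
    (X : C(Set.Icc 0 T, Lp ℝ 2 P)) :
    Continuous (fun t : Set.Icc 0 T => ∫ s in (0 : ℝ)..t, a s • X (Set.projIcc 0 T hT s)) := by
  have h := intervalIntegral.continuousOn_primitive_interval'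
    (intervalIntegrable_smul_curve hT ha X) (Set.left_mem_uIcc (a := (0 : ℝ)))
  rw [Set.uIcc_of_le hT] at h
  exact h.domRestrict

theorem drift_mem_lpMeas {a : ℝ → ℝ} (hT : 0 ≤ T) (ha : Integrable a (timeMeasure T))
    {X : C(Set.Icc 0 T, Lp ℝ 2 P)} (hX : IsAdaptedCurve P 𝓕 X) (t : Set.Icc 0 T) :
    ∫ s in (0 : ℝ)..t, a s • X (Set.projIcc 0 T hT s) ∈ lpMeas ℝ ℝ (𝓕 ⟨t, t.2.1⟩) 2 P := by
  have : Fact (𝓕 ⟨t, t.2.1⟩ ≤ mΩ) := ⟨𝓕.le _⟩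
  have hi := (intervalIntegrable_smul_curve hT ha X).mono_set
    (uIcc_subset_of_mem_Icc t.2)
  rw [intervalIntegral.integral_of_le t.2.1]
  rw [intervalIntegrable_iff_integrableOn_Ioc_of_le t.2.1] at hi
  refine Submodule.integral_mem_of_isComplete _ hi ?_
  filter_upwards [ae_restrict_mem measurableSet_Ioc] with s hs
  refine Submodule.smul_mem _ _ ?_
  have hs' : s ∈ Set.Icc 0 T := ⟨hs.1.le, hs.2.trans t.2.2⟩
  rw [Set.projIcc_of_mem hT hs']
  have h1 := hX ⟨s, hs'⟩
  rw [mem_lpMeas_iff_aestronglyMeasurable] at h1 ⊢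
  exact h1.mono (𝓕.mono (show (⟨s, hs'.1⟩ : ℝ≥0) ≤ ⟨t, t.2.1⟩ from hs.2))

/-- Integrating the weight `exp (r s)` gains the factor `1 / r`. -/
theorem norm_drift_sub_le {a : ℝ → ℝ} (hT : 0 ≤ T) (ha : Integrable a (timeMeasure T)) {A : ℝ}
    (hA : ∀ t ∈ Set.Icc 0 T, |a t| ≤ A) {X Y : C(Set.Icc 0 T, Lp ℝ 2 P)} {M r : ℝ} (hr : 0 < r)
    (h : ∀ s, ‖X s - Y s‖ ≤ M * Real.exp (r * s)) (t : Set.Icc 0 T) :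
    ‖(∫ s in (0 : ℝ)..t, a s • X (Set.projIcc 0 T hT s)) -
      ∫ s in (0 : ℝ)..t, a s • Y (Set.projIcc 0 T hT s)‖ ≤ A / r * (M * Real.exp (r * t)) := by
  have hsub : Set.uIcc 0 (t : ℝ) ⊆ Set.uIcc 0 T :=
    uIcc_subset_of_mem_Icc t.2
  have h0 : (0 : ℝ) ∈ Set.Icc 0 T := ⟨le_rfl, hT⟩
  have hA0 : 0 ≤ A := (abs_nonneg _).trans (hA 0 h0)
  have hM : 0 ≤ M := by
    have := (norm_nonneg _).trans (h ⟨0, h0⟩)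
    simpa using this
  rw [← intervalIntegral.integral_sub ((intervalIntegrable_smul_curve hT ha X).mono_set hsub)
    ((intervalIntegrable_smul_curve hT ha Y).mono_set hsub)]
  have hc : Continuous (fun s : ℝ => A * M * Real.exp (r * s)) := by fun_prop
  refine (intervalIntegral.norm_integral_le_of_norm_le t.2.1 (g := fun s => A * M *
    Real.exp (r * s)) (.of_forall fun s hs => ?_) (hc.intervalIntegrable _ _)).trans ?_
  · have hs' : s ∈ Set.Icc 0 T := ⟨hs.1.le, hs.2.trans t.2.2⟩
    rw [Set.projIcc_of_mem hT hs', ← smul_sub, norm_smul, mul_assoc]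
    exact mul_le_mul (hA s hs') (h ⟨s, hs'⟩) (norm_nonneg _) hA0
  · rw [intervalIntegral.integral_const_mul]
    refine (mul_le_mul_of_nonneg_left (integral_exp_mul_le hr) (mul_nonneg hA0 hM)).trans_eq ?_
    ring

theorem integrable_bounded_mul [IsProbabilityMeasure P] {a : ℝ → ℝ}
    (ham : AEStronglyMeasurable a (timeMeasure T)) {A : ℝ}
    (hA : ∀ t ∈ Set.Icc 0 T, |a t| ≤ A) {y : ℝ → Ω → ℝ}
    (hy : MemLp (fun p : ℝ × Ω => y p.1 p.2) 2 ((timeMeasure T).prod P)) :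
    Integrable (fun p : ℝ × Ω => a p.1 * y p.1 p.2) ((timeMeasure T).prod P) := by
  refine (hy.integrable (by norm_num)).bdd_mul (c := A) ham.comp_fst ?_
  filter_upwards [SimpleProcess.ae_timeMeasure_prod_le (P := P) T] with p hp using hA _ hp

/-- Pairing with the indicator of `B` commutes with the Bochner integral, and Fubini turns the
result into the pathwise integral over `B`; agreement on all `B` gives equality a.e. -/
theorem drift_ae_eq [IsProbabilityMeasure P] {a : ℝ → ℝ} (hT : 0 ≤ T)
    (ha : Integrable a (timeMeasure T)) {A : ℝ}
    (hA : ∀ t ∈ Set.Icc 0 T, |a t| ≤ A) {X : C(Set.Icc 0 T, Lp ℝ 2 P)} {y : ℝ → Ω → ℝ}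
    (hy : IsRealization 𝓕 X y) (t : Set.Icc 0 T) :
    (∫ s in (0 : ℝ)..t, a s • X (Set.projIcc 0 T hT s) : Lp ℝ 2 P) =ᵐ[P]
      fun ω => ∫ s in (0 : ℝ)..t, a s * y s ω := by
  have hμ : volume.restrict (Set.Ioc 0 (t : ℝ)) ≤ timeMeasure T :=
    Measure.restrict_mono (Set.Ioc_subset_Icc_self.trans (Set.Icc_subset_Icc_right t.2.2)) le_rfl
  have hi : Integrable (fun p : ℝ × Ω => a p.1 * y p.1 p.2)
      ((volume.restrict (Set.Ioc 0 (t : ℝ))).prod P) :=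
    (integrable_bounded_mul ha.aestronglyMeasurable hA hy.memLp).mono_measure
      (Measure.prod_mono hμ le_rfl)
  have hX := (intervalIntegrable_smul_curve hT ha X).mono_set (uIcc_subset_of_mem_Icc t.2)
  refine Integrable.ae_eq_of_forall_setIntegral_eq _ _ ((Lp.memLp _).integrable (by norm_num))
    ?_ fun B hB hPB => ?_
  · simp_rw [intervalIntegral.integral_of_le t.2.1]
    exact hi.integral_prod_right
  rw [← L2.inner_indicatorConstLp_one (𝕜 := ℝ) hB hPB.ne, ← innerSL_apply_apply ℝ,
    ← ContinuousLinearMap.intervalIntegral_comp_comm _ hX]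
  simp_rw [intervalIntegral.integral_of_le t.2.1]
  rw [← integral_integral_swap (μ := volume.restrict (Set.Ioc 0 (t : ℝ))) (ν := P.restrict B)
    (f := fun s ω => a s * y s ω)
    (hi.mono_measure (Measure.prod_mono le_rfl Measure.restrict_le_self))]
  refine integral_congr_ae ?_
  filter_upwards [ae_restrict_mem measurableSet_Ioc] with s hs
  have hs' : s ∈ Set.Icc 0 T := ⟨hs.1.le, hs.2.trans t.2.2⟩
  rw [innerSL_apply_apply, inner_smul_right, L2.inner_indicatorConstLp_one (𝕜 := ℝ) hB hPB.ne,
    Set.projIcc_of_mem hT hs', integral_const_mul]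
  congr 1
  exact integral_congr_ae (ae_restrict_of_ae (hy.ae_eq ⟨s, hs'⟩).symm)

end Drift

theorem IsLipschitzPair.nonneg {C : ℝ} {σ : ℝ → ℝ → ℝ} (h : IsLipschitzPair C σ) : 0 ≤ C := by
  have := (abs_nonneg _).trans (h 1 0 0 0)
  simpa using this

theorem isClosed_isAdaptedCurve {Ω : Type*} {mΩ : MeasurableSpace Ω} {P : Measure Ω}
    {𝓕 : Filtration ℝ≥0 mΩ} {T : ℝ} :
    IsClosed {X : C(Set.Icc 0 T, Lp ℝ 2 P) | IsAdaptedCurve P 𝓕 X} := by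
  simp only [IsAdaptedCurve, Set.ofPred_forall]
  refine isClosed_iInter fun t => ?_
  have : Fact (𝓕 ⟨t, t.2.1⟩ ≤ mΩ) := ⟨𝓕.le _⟩
  have hc : IsClosed (lpMeas ℝ ℝ (𝓕 ⟨t, t.2.1⟩) 2 P : Set (Lp ℝ 2 P)) :=
    (completeSpace_coe_iff_isComplete.1
      (inferInstance : CompleteSpace (lpMeas ℝ ℝ (𝓕 ⟨t, t.2.1⟩) 2 P))).isClosed
  exact hc.preimage (continuous_eval_const t)

/-! ### Picard iteration for the state equation -/

section Picard

variable {Ω : Type*} {mΩ : MeasurableSpace Ω} {P : Measure Ω} [IsProbabilityMeasure P]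
  {𝓕 : Filtration ℝ≥0 mΩ} {W : ℝ≥0 → Ω → ℝ} {T : ℝ}

/-- The control is the same on both sides, so only `y - y'` enters the isometry on `[0, t]`. The
squared weight `exp (2 r s)` integrates to at most `exp (2 r t) / (2 r)`, whence the square root. -/
theorem IsItoIntegral.norm_toLp_sub_le (hW : IsBrownianMotionFor P 𝓕 W)
    {X X' : C(Set.Icc 0 T, Lp ℝ 2 P)} {y y' : ℝ → Ω → ℝ} (hy : IsRealization 𝓕 X y)
    (hy' : IsRealization 𝓕 X' y') {C : ℝ} {σ : ℝ → ℝ → ℝ} (hσ : IsLipschitzPair C σ)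
    {u : ℝ → ℝ} {I I' : ℝ≥0 → Ω → ℝ}
    (hI : IsItoIntegral P 𝓕 W T (fun t ω => σ (y t ω) (u t)) I)
    (hI' : IsItoIntegral P 𝓕 W T (fun t ω => σ (y' t ω) (u t)) I') {M r : ℝ} (hr : 0 < r)
    (h : ∀ s, ‖X s - X' s‖ ≤ M * Real.exp (r * s)) (t : Set.Icc 0 T) :
    ‖(hI.integral_memLp ⟨t, t.2.1⟩ t.2.2).toLp - (hI'.integral_memLp ⟨t, t.2.1⟩ t.2.2).toLp‖ ≤
      C / Real.sqrt (2 * r) * (M * Real.exp (r * t)) := by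
  have hC := hσ.nonneg
  have hM : 0 ≤ M := by
    have := (norm_nonneg _).trans (h ⟨0, le_rfl, t.2.1.trans t.2.2⟩)
    simpa using this
  have hμ := timeMeasure_prod_mono P t.2.2
  have hm := (hI.integrand_memLp.aestronglyMeasurable.sub
    hI'.integrand_memLp.aestronglyMeasurable).mono_measure hμ
  have key : eLpNorm (fun ω => I ⟨t, t.2.1⟩ ω - I' ⟨t, t.2.1⟩ ω) 2 P ^ 2 ≤
      ENNReal.ofReal (C / Real.sqrt (2 * r) * (M * Real.exp (r * t))) ^ 2 := by
    refine (pow_le_pow_left' (hI.eLpNorm_sub_le hW hI' (t := ⟨t, t.2.1⟩) t.2.2) 2).trans ?_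
    change eLpNorm _ 2 ((timeMeasure (t : ℝ)).prod P) ^ 2 ≤ _
    rw [eLpNorm_two_sq_prod (f := fun s ω => σ (y s ω) (u s) - σ (y' s ω) (u s)) hm]
    have hb : ∀ᵐ s ∂(timeMeasure t), eLpNorm (fun ω => σ (y s ω) (u s) - σ (y' s ω) (u s)) 2 P ^ 2
        ≤ ENNReal.ofReal ((C * M) ^ 2 * Real.exp (2 * r * s)) := by
      filter_upwards [ae_restrict_mem measurableSet_Icc] with s hs
      have hs' : s ∈ Set.Icc 0 T := ⟨hs.1, hs.2.trans t.2.2⟩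
      have e : (C * M) ^ 2 * Real.exp (2 * r * s) = (C * (M * Real.exp (r * s))) ^ 2 := by
        rw [mul_pow, mul_pow, mul_pow, ← Real.exp_nat_mul]
        push_cast
        ring_nf
      rw [e, ENNReal.ofReal_pow (by positivity), ENNReal.ofReal_mul hC]
      refine pow_le_pow_left' ?_ 2
      refine (hσ.eLpNorm_sub_le (hy.memLp_apply ⟨s, hs'⟩).aestronglyMeasurable
        aestronglyMeasurable_const (hy'.memLp_apply ⟨s, hs'⟩).aestronglyMeasurable
        aestronglyMeasurable_const).trans ?_
      gcongr
      simp only [sub_self]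
      rw [eLpNorm_zero', add_zero, hy.eLpNorm_sub hy' ⟨s, hs'⟩ ⟨s, hs'⟩, dist_eq_norm]
      exact ENNReal.ofReal_le_ofReal (h ⟨s, hs'⟩)
    refine (lintegral_mono_ae hb).trans ?_
    have hc : Continuous (fun s : ℝ => (C * M) ^ 2 * Real.exp (2 * r * s)) := by fun_prop
    rw [← ofReal_integral_eq_lintegral_ofReal hc.integrableOn_Icc
      (.of_forall fun s => by positivity), ← ENNReal.ofReal_pow (by positivity)]
    refine ENNReal.ofReal_le_ofReal ?_
    rw [integral_Icc_eq_integral_Ioc, ← intervalIntegral.integral_of_le t.2.1,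
      intervalIntegral.integral_const_mul]
    refine (mul_le_mul_of_nonneg_left (integral_exp_mul_le (by positivity))
      (sq_nonneg _)).trans_eq ?_
    rw [mul_pow (C / _), div_pow, Real.sq_sqrt (by positivity), mul_pow M, ← Real.exp_nat_mul]
    push_cast
    ring_nf
  rw [← dist_eq_norm, Lp.dist_def, eLpNorm_congr_ae ((MemLp.coeFn_toLp _).sub (MemLp.coeFn_toLp _))]
  refine ENNReal.toReal_le_of_le_ofReal (by positivity) ?_
  exact (ENNReal.pow_le_pow_left_iff two_ne_zero).1 key

/-- `X'` is obtained from `X` by one Picard iteration for the equation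
`dX = a X dt + dD + σ(X, u) dW`. -/
def IsPicardStep (P : Measure Ω) [IsProbabilityMeasure P] (𝓕 : Filtration ℝ≥0 mΩ)
    (W : ℝ≥0 → Ω → ℝ) {T : ℝ} (hT : 0 ≤ T) (a u : ℝ → ℝ) (σ : ℝ → ℝ → ℝ)
    (D : C(Set.Icc 0 T, ℝ)) (X X' : C(Set.Icc 0 T, Lp ℝ 2 P)) : Prop :=
  ∃ (y : ℝ → Ω → ℝ) (I : ℝ≥0 → Ω → ℝ)
    (hI : IsItoIntegral P 𝓕 W T (fun t ω => σ (y t ω) (u t)) I), IsRealization 𝓕 X y ∧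
    ∀ t : Set.Icc 0 T, X' t = Lp.constL 2 P ℝ (D t) +
      (∫ s in (0 : ℝ)..t, a s • X (Set.projIcc 0 T hT s)) +
      (hI.integral_memLp ⟨t, t.2.1⟩ t.2.2).toLp

theorem exists_isPicardStep (hW : IsBrownianMotionFor P 𝓕 W) (hT : 0 ≤ T) {a u : ℝ → ℝ}
    (ha : Integrable a (timeMeasure T)) (hu : MemLp u 2 (timeMeasure T)) {C : ℝ}
    {σ : ℝ → ℝ → ℝ} (hσ : IsLipschitzPair C σ) (D : C(Set.Icc 0 T, ℝ))
    {X : C(Set.Icc 0 T, Lp ℝ 2 P)} (hX : IsAdaptedCurve P 𝓕 X) :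
    ∃ X' : C(Set.Icc 0 T, Lp ℝ 2 P), IsAdaptedCurve P 𝓕 X' ∧ IsPicardStep P 𝓕 W hT a u σ D X X' := by
  obtain ⟨y, hy⟩ := exists_isRealization X hX
  obtain ⟨I, hI⟩ := hy.exists_isItoIntegral hW hT hσ hu
  refine ⟨⟨fun t => Lp.constL 2 P ℝ (D t) +
      (∫ s in (0 : ℝ)..t, a s • X (Set.projIcc 0 T hT s)) +
      (hI.integral_memLp ⟨t, t.2.1⟩ t.2.2).toLp, ?_⟩, fun t => ?_, y, I, hI, hy, fun t => rfl⟩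
  · exact (((Lp.constL 2 P ℝ).continuous.comp D.continuous).add (continuous_drift hT ha X)).add
      (hI.continuous_toLp hW)
  · refine Submodule.add_mem _ (Submodule.add_mem _ ?_ (drift_mem_lpMeas hT ha hX t))
      (hI.toLp_mem_lpMeas hW (t := ⟨t, t.2.1⟩) t.2.2)
    rw [mem_lpMeas_iff_aestronglyMeasurable]
    exact (aestronglyMeasurable_const (b := D t)).congr (Lp.coeFn_const _ _ _).symm

/-- The bound holds for every choice of realizations and integrals, so a Picard map may be picked by
choice and still contracts. -/
theorem IsPicardStep.norm_sub_le (hW : IsBrownianMotionFor P 𝓕 W) {hT : 0 ≤ T} {a u : ℝ → ℝ}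
    (ha : Integrable a (timeMeasure T)) {A : ℝ} (hA : ∀ t ∈ Set.Icc 0 T, |a t| ≤ A)
    {C : ℝ} {σ : ℝ → ℝ → ℝ} (hσ : IsLipschitzPair C σ) {D : C(Set.Icc 0 T, ℝ)}
    {X X' Y Y' : C(Set.Icc 0 T, Lp ℝ 2 P)} (h : IsPicardStep P 𝓕 W hT a u σ D X X')
    (h' : IsPicardStep P 𝓕 W hT a u σ D Y Y') {M r : ℝ} (hr : 0 < r)
    (hXY : ∀ s, ‖X s - Y s‖ ≤ M * Real.exp (r * s)) (t : Set.Icc 0 T) :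
    ‖X' t - Y' t‖ ≤ (A / r + C / Real.sqrt (2 * r)) * (M * Real.exp (r * t)) := by
  obtain ⟨y, I, hI, hy, e⟩ := h
  obtain ⟨y', I', hI', hy', e'⟩ := h'
  rw [e t, e' t, add_sub_add_comm, add_sub_add_left_eq_sub, add_mul]
  exact (norm_add_le _ _).trans (add_le_add (norm_drift_sub_le hT ha hA hr hXY t)
    (IsItoIntegral.norm_toLp_sub_le hW hy hy' hσ hI hI' hr hXY t))

theorem exists_pos_rate (A C : ℝ) : ∃ r : ℝ, 0 < r ∧ A / r + C / Real.sqrt (2 * r) ≤ 1 / 2 := by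
  have h1 : Tendsto (fun r : ℝ => A / r + C / Real.sqrt (2 * r)) atTop (𝓝 (0 + 0)) := by
    refine (tendsto_const_nhds.div_atTop tendsto_id).add (tendsto_const_nhds.div_atTop ?_)
    exact Real.tendsto_sqrt_atTop.comp (tendsto_id.const_mul_atTop two_pos)
  rw [add_zero] at h1
  obtain ⟨r, h, hr⟩ := ((h1.eventually (ge_mem_nhds (show (0 : ℝ) < 1 / 2 by norm_num))).and
    (eventually_gt_atTop 0)).exists
  exact ⟨r, hr, h⟩

/-- The linear-drift stochastic differential equation has an adapted solution. -/
theorem exists_isPicardStep_self (hW : IsBrownianMotionFor P 𝓕 W) (hT : 0 ≤ T) {a u : ℝ → ℝ}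
    (ha : Integrable a (timeMeasure T)) {A : ℝ} (hA : ∀ t ∈ Set.Icc 0 T, |a t| ≤ A)
    (hu : MemLp u 2 (timeMeasure T)) {C : ℝ}
    {σ : ℝ → ℝ → ℝ} (hσ : IsLipschitzPair C σ) (D : C(Set.Icc 0 T, ℝ)) :
    ∃ X : C(Set.Icc 0 T, Lp ℝ 2 P), IsPicardStep P 𝓕 W hT a u σ D X X := by
  -- The map is made total with an arbitrary value off the adapted curves, where nothing is asked of
  -- it.
  have hstep : ∀ X : C(Set.Icc 0 T, Lp ℝ 2 P), ∃ X' : C(Set.Icc 0 T, Lp ℝ 2 P), IsAdaptedCurve P 𝓕 X →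
      IsAdaptedCurve P 𝓕 X' ∧ IsPicardStep P 𝓕 W hT a u σ D X X' := by
    intro X
    by_cases hX : IsAdaptedCurve P 𝓕 X
    · obtain ⟨X', h⟩ := exists_isPicardStep hW hT ha hu hσ D hX
      exact ⟨X', fun _ => h⟩
    · exact ⟨X, fun h => absurd h hX⟩
  choose Φ hΦ using hstep
  obtain ⟨r, hr, hrate⟩ := exists_pos_rate A C
  obtain ⟨X, hX, hfix⟩ := exists_isFixedPt_of_exp_bound (Φ := Φ) (r := r)
    (isClosed_isAdaptedCurve (P := P) (𝓕 := 𝓕) (T := T)) ⟨0, fun t => Submodule.zero_mem _⟩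
    (fun X hX c t => Submodule.smul_mem _ (c t) (hX t)) (fun X hX => (hΦ X hX).1)
    fun X hX Y hY M hM hXY t => ((hΦ X hX).2.norm_sub_le hW ha hA hσ
      (hΦ Y hY).2 hr hXY t).trans (by gcongr)
  refine ⟨X, ?_⟩
  have := (hΦ X hX).2
  rwa [hfix] at this

end Picard

/-! ### States, their means and the constraint functional -/

namespace LinearSOCP

variable {S : LinearSOCP}

namespace Assumptions

theorem exists_isLipschitzPair (hS : S.Assumptions) : ∃ C, IsLipschitzPair C S.σ := by
  obtain ⟨C, hC⟩ := hS.σ_bound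
  have hd := hS.σ_contDiff.differentiable one_ne_zero
  refine ⟨C, fun y u y' u' => ?_⟩
  have h1 : |S.σ y u - S.σ y' u| ≤ C * |y - y'| :=
    Convex.norm_image_sub_le_of_norm_deriv_le (f := fun y => S.σ y u)
      (fun x _ => (hd.comp (differentiable_id.prodMk (differentiable_const u))) x)
      (fun x _ => (le_add_of_nonneg_right (abs_nonneg _)).trans (hC x u)) convex_univ
      (Set.mem_univ _) (Set.mem_univ _)
  have h2 : |S.σ y' u - S.σ y' u'| ≤ C * |u - u'| :=
    Convex.norm_image_sub_le_of_norm_deriv_le (f := fun u => S.σ y' u)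
      (fun x _ => (hd.comp ((differentiable_const y').prodMk differentiable_id)) x)
      (fun x _ => (le_add_of_nonneg_left (abs_nonneg _)).trans (hC y' x)) convex_univ
      (Set.mem_univ _) (Set.mem_univ _)
  linarith [abs_sub_le (S.σ y u) (S.σ y' u) (S.σ y' u')]

theorem exists_by_bound (hS : S.Assumptions) : ∃ A, ∀ t ∈ Set.Icc 0 S.T, |S.by' t| ≤ A :=
  let ⟨C, hC⟩ := hS.b_bound
  ⟨C, fun t ht => (le_add_of_nonneg_right (abs_nonneg _)).trans (hC t ht)⟩

theorem exists_bu_bound (hS : S.Assumptions) : ∃ A, ∀ t ∈ Set.Icc 0 S.T, |S.bu' t| ≤ A :=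
  let ⟨C, hC⟩ := hS.b_bound
  ⟨C, fun t ht => (le_add_of_nonneg_left (abs_nonneg _)).trans (hC t ht)⟩

theorem memLp_bu (hS : S.Assumptions) : MemLp S.bu' 2 (timeMeasure S.T) := by
  obtain ⟨A, hA⟩ := hS.exists_bu_bound
  exact MemLp.of_bound hS.bu_meas A ((ae_restrict_mem measurableSet_Icc).mono hA)

theorem integrable_by (hS : S.Assumptions) : Integrable S.by' (timeMeasure S.T) := by
  obtain ⟨A, hA⟩ := hS.exists_by_bound
  exact (MemLp.of_bound (p := 2) hS.by_meas A
    ((ae_restrict_mem measurableSet_Icc).mono hA)).integrable (by norm_num)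

theorem integrable_source (hS : S.Assumptions) (u : Control S.T) :
    Integrable (fun t => S.bu' t * u t + S.m t) (timeMeasure S.T) :=
  (hS.memLp_bu.integrable_mul (Lp.memLp u)).add hS.m_integrable

end Assumptions

theorem b_eq (S : LinearSOCP) (t y u : ℝ) :
    S.b t y u = S.by' t * y + (S.bu' t * u + S.m t) := by
  rw [b]; ring

section Stochastic

variable {Ω : Type*} {mΩ : MeasurableSpace Ω} {P : Measure Ω} [IsProbabilityMeasure P]
  {𝓕 : Filtration ℝ≥0 mΩ} {W : ℝ≥0 → Ω → ℝ}

theorem integrable_drift (hS : S.Assumptions) (u : Control S.T) {y : ℝ → Ω → ℝ}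
    (hy : MemLp (fun p : ℝ × Ω => y p.1 p.2) 2 ((timeMeasure S.T).prod P)) :
    Integrable (fun p : ℝ × Ω => S.b p.1 (y p.1 p.2) (u p.1)) ((timeMeasure S.T).prod P) := by
  obtain ⟨A, hA⟩ := hS.exists_by_bound
  simp_rw [b_eq]
  exact (integrable_bounded_mul hS.by_meas hA hy).add ((hS.integrable_source u).comp_fst P)

theorem exists_isState (hS : S.Assumptions) (hW : IsBrownianMotionFor P 𝓕 W) (u : Control S.T) :
    ∃ y, S.IsState P 𝓕 W u y := by
  obtain ⟨C, hσ⟩ := hS.exists_isLipschitzPair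
  obtain ⟨A, hA⟩ := hS.exists_by_bound
  have hT := hS.T_pos.le
  have hf := hS.integrable_source u
  -- The source `b_u' u + m` is deterministic but only integrable in time, so it enters as its
  -- continuous primitive.
  have hD : Continuous (fun t : Set.Icc 0 S.T =>
      S.y₀ + ∫ s in (0 : ℝ)..t, (S.bu' s * u s + S.m s)) := by
    have h := intervalIntegral.continuousOn_primitive_interval'
      (intervalIntegrable_of_integrable_timeMeasure hT hf) (Set.left_mem_uIcc (a := (0 : ℝ)))
    rw [Set.uIcc_of_le hT] at h
    exact continuous_const.add h.domRestrict
  obtain ⟨X, y, I, hI, hy, hX⟩ := exists_isPicardStep_self hW hT hS.integrable_by hA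
    (Lp.memLp u) hσ ⟨_, hD⟩
  refine ⟨y, ⟨hy.adapted, hy.memLp⟩, I, hI, fun t ht => ?_⟩
  have hXt := hX ⟨t, t.2, ht⟩
  have hyX : y t =ᵐ[P] X ⟨t, t.2, ht⟩ := hy.ae_eq ⟨t, t.2, ht⟩
  have hi : ∀ᵐ ω ∂P, Integrable (fun s => S.by' s * y s ω) (timeMeasure S.T) :=
    (integrable_bounded_mul hS.by_meas hA hy.memLp).prod_left_ae
  rw [hXt] at hyX
  filter_upwards [hyX, Lp.coeFn_add (Lp.constL 2 P ℝ _ +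
      (∫ s in (0 : ℝ)..t, S.by' s • X (Set.projIcc 0 S.T hT s))) (hI.integral_memLp t ht).toLp,
    Lp.coeFn_add (Lp.constL 2 P ℝ (S.y₀ + ∫ s in (0 : ℝ)..t, (S.bu' s * u s + S.m s)))
      (∫ s in (0 : ℝ)..t, S.by' s • X (Set.projIcc 0 S.T hT s)),
    Lp.coeFn_const (p := 2) (μ := P) (S.y₀ + ∫ s in (0 : ℝ)..t, (S.bu' s * u s + S.m s)),
    drift_ae_eq hT hS.integrable_by hA hy ⟨t, t.2, ht⟩, (hI.integral_memLp t ht).coeFn_toLp, hi]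
    with ω h1 h2 h3 h4 h5 h6 h7
  have hsub : Set.uIcc 0 (t : ℝ) ⊆ Set.uIcc 0 S.T := uIcc_subset_of_mem_Icc ⟨t.2, ht⟩
  rw [h1]
  refine h2.trans ?_
  rw [Pi.add_apply, h6]
  congr 1
  refine h3.trans ?_
  rw [Pi.add_apply, h5]
  refine (congrArg (· + _) h4).trans ?_
  simp_rw [b_eq]
  rw [intervalIntegral.integral_add
    ((intervalIntegrable_of_integrable_timeMeasure hT h7).mono_set hsub)
    ((intervalIntegrable_of_integrable_timeMeasure hT hf).mono_set hsub)]
  simp only [Function.const_apply]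
  ring

theorem isState_state (hS : S.Assumptions) (hW : IsBrownianMotionFor P 𝓕 W) (u : Control S.T) :
    S.IsState P 𝓕 W u (S.state P 𝓕 W u) := by
  have h := exists_isState hS hW u
  rw [state, dif_pos h]
  exact h.choose_spec

namespace IsState

variable {u : Control S.T} {y : ℝ → Ω → ℝ}

theorem integrable (h : S.IsState P 𝓕 W u y) :
    Integrable (fun p : ℝ × Ω => y p.1 p.2) ((timeMeasure S.T).prod P) :=
  h.memL2.memLp.integrable (by norm_num)

/-- The mean of the state solves a linear ordinary differential equation. -/
theorem mean_eq (hS : S.Assumptions) (hW : IsBrownianMotionFor P 𝓕 W)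
    (h : S.IsState P 𝓕 W u y) : ∀ t ∈ Set.Icc 0 S.T, ∫ ω, y t ω ∂P =
      S.y₀ + ∫ s in (0 : ℝ)..t, (S.by' s * (∫ ω, y s ω ∂P) + (S.bu' s * u s + S.m s)) := by
  intro t ht
  obtain ⟨I, hI, he⟩ := h.equation
  have hμ : volume.restrict (Set.Ioc 0 t) ≤ timeMeasure S.T :=
    Measure.restrict_mono (Set.Ioc_subset_Icc_self.trans (Set.Icc_subset_Icc_right ht.2)) le_rfl
  have hb : Integrable (fun p : ℝ × Ω => S.b p.1 (y p.1 p.2) (u p.1))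
      ((volume.restrict (Set.Ioc 0 t)).prod P) :=
    (integrable_drift hS u h.memL2.memLp).mono_measure (Measure.prod_mono hμ le_rfl)
  -- The noise drops out here; because the drift is linear in `y`, Fubini closes the equation on the
  -- mean.
  have h0 := hI.integral_eq_zero hW (t := ⟨t, ht.1⟩) ht.2
  have hi := (hI.integral_memLp ⟨t, ht.1⟩ ht.2).integrable (by norm_num)
  have he' : y t =ᵐ[P] fun ω => S.y₀ + (∫ s in (0 : ℝ)..t, S.b s (y s ω) (u s)) + I ⟨t, ht.1⟩ ω :=
    he ⟨t, ht.1⟩ ht.2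
  rw [integral_congr_ae he']
  simp only [intervalIntegral.integral_of_le ht.1]
  have hbi : Integrable (fun ω => ∫ s in Set.Ioc 0 t, S.b s (y s ω) (u s)) P :=
    hb.integral_prod_right
  rw [integral_add (f := fun ω => S.y₀ + ∫ s in Set.Ioc 0 t, S.b s (y s ω) (u s))
      ((integrable_const _).add hbi) hi, h0, add_zero,
    integral_add (integrable_const _) hbi, integral_const, probReal_univ,
    one_smul, ← integral_integral_swap hb]
  congr 1
  refine integral_congr_ae ?_
  filter_upwards [(h.integrable.mono_measure (Measure.prod_mono hμ le_rfl)).prod_right_ae]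
    with s hs
  simp_rw [b_eq]
  rw [integral_add (hs.const_mul _) (integrable_const _), integral_const_mul, integral_const,
    probReal_univ, one_smul]

/-- A state is only adapted and square integrable; continuity of its mean is read off the right side
of `mean_eq`, a primitive of an integrable function. -/
theorem continuousOn_mean (hS : S.Assumptions) (hW : IsBrownianMotionFor P 𝓕 W)
    (h : S.IsState P 𝓕 W u y) : ContinuousOn (fun t => ∫ ω, y t ω ∂P) (Set.Icc 0 S.T) := by
  have hT := hS.T_pos.le
  obtain ⟨A, hA⟩ := hS.exists_by_bound
  have hz : Integrable (fun s => S.by' s * ∫ ω, y s ω ∂P) (timeMeasure S.T) :=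
    h.integrable.integral_prod_left.bdd_mul (c := A) hS.by_meas
      ((ae_restrict_mem measurableSet_Icc).mono hA)
  have hc := intervalIntegral.continuousOn_primitive_interval'
    (intervalIntegrable_of_integrable_timeMeasure hT (hz.add (hS.integrable_source u)))
    (Set.left_mem_uIcc (a := (0 : ℝ)))
  rw [Set.uIcc_of_le hT] at hc
  exact (continuousOn_const.add hc).congr (h.mean_eq hS hW)

end IsState

theorem expectedIntegral_eq (hS : S.Assumptions) (hW : IsBrownianMotionFor P 𝓕 W)
    (u : Control S.T) : S.expectedIntegral P 𝓕 W u = S.G P 𝓕 W u + S.δ := by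
  have h := (isState_state hS hW u).integrable
  have hμ : volume.restrict (Set.Ioc 0 S.T) ≤ timeMeasure S.T :=
    Measure.restrict_mono Set.Ioc_subset_Icc_self le_rfl
  rw [G, sub_add_cancel, expectedIntegral]
  simp_rw [intervalIntegral.integral_of_le hS.T_pos.le]
  exact (integral_integral_swap (f := fun t ω => S.state P 𝓕 W u t ω)
    (h.mono_measure (Measure.prod_mono hμ le_rfl))).symm

/-- The adjoint pairing for the mean. The right side does not mention the state, so the choice made
in `state` is immaterial. -/
theorem G_eq (hS : S.Assumptions) (hW : IsBrownianMotionFor P 𝓕 W) {ψ : ℝ → ℝ} (hψ : S.IsPsi ψ)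
    (u : Control S.T) : S.G P 𝓕 W u =
      ψ 0 * S.y₀ + (∫ t in (0 : ℝ)..S.T, ψ t * (S.bu' t * u t + S.m t)) - S.δ := by
  have h := isState_state hS hW u
  have hT := hS.T_pos.le
  rw [G, integral_eq_of_adjoint hT
    (intervalIntegrable_of_integrable_timeMeasure hT hS.integrable_by)
    (intervalIntegrable_of_integrable_timeMeasure hT (hS.integrable_source u)) hψ.1 hψ.2
    (h.continuousOn_mean hS hW) (h.mean_eq hS hW)]

end Stochastic

/-! ### The gradient `ψ b_u'` of the constraint -/

theorem IsPsi.memLp_mul_bu (hS : S.Assumptions) {ψ : ℝ → ℝ} (hψ : S.IsPsi ψ) :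
    MemLp (fun t => ψ t * S.bu' t) 2 (timeMeasure S.T) := by
  obtain ⟨A, hA⟩ := hS.exists_bu_bound
  obtain ⟨B, hB⟩ := isCompact_Icc.exists_bound_of_continuousOn hψ.1
  refine MemLp.of_bound ((hψ.1.aestronglyMeasurable measurableSet_Icc).mul hS.bu_meas) (B * A) ?_
  filter_upwards [ae_restrict_mem measurableSet_Icc] with t ht
  rw [norm_mul]
  exact mul_le_mul (hB t ht) (hA t ht) (norm_nonneg _) ((norm_nonneg _).trans (hB t ht))

theorem G_sub_eq_inner {Ω : Type*} {mΩ : MeasurableSpace Ω} {P : Measure Ω}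
    [IsProbabilityMeasure P] {𝓕 : Filtration ℝ≥0 mΩ} {W : ℝ≥0 → Ω → ℝ} (hS : S.Assumptions)
    (hW : IsBrownianMotionFor P 𝓕 W) {ψ : ℝ → ℝ} (hψ : S.IsPsi ψ) (v w : Control S.T) :
    S.G P 𝓕 W v - S.G P 𝓕 W w = inner ℝ (hψ.memLp_mul_bu hS).toLp (v - w) := by
  have hT := hS.T_pos.le
  have hi : ∀ u : Control S.T,
      IntervalIntegrable (fun t => ψ t * (S.bu' t * u t + S.m t)) volume 0 S.T := fun u =>
    (intervalIntegrable_of_integrable_timeMeasure hT (hS.integrable_source u)).continuousOn_mul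
      (Set.uIcc_of_le hT ▸ hψ.1)
  rw [G_eq hS hW hψ, G_eq hS hW hψ, L2.inner_def, sub_sub_sub_cancel_right,
    add_sub_add_left_eq_sub, ← intervalIntegral.integral_sub (hi v) (hi w),
    intervalIntegral.integral_of_le hT, ← integral_Icc_eq_integral_Ioc]
  refine integral_congr_ae ?_
  filter_upwards [(hψ.memLp_mul_bu hS).coeFn_toLp, Lp.coeFn_sub v w] with t h1 h2
  rw [h1, h2, Pi.sub_apply, Real.inner_apply]
  ring

theorem intervalIntegrable_bu_sq_mul (hS : S.Assumptions) {ψ : ℝ → ℝ}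
    (hψ : ContinuousOn ψ (Set.Icc 0 S.T)) :
    IntervalIntegrable (fun t => S.bu' t ^ 2 * ψ t) volume 0 S.T :=
  (intervalIntegrable_of_integrable_timeMeasure hS.T_pos.le
    hS.memLp_bu.integrable_sq).mul_continuousOn (Set.uIcc_of_le hS.T_pos.le ▸ hψ)

/-- The adjoint pairing with zero initial value and source `(b_u')² ψ`, which `ψ` turns into `(ψ
b_u')²`. -/
theorem IsPhi.integral_eq (hS : S.Assumptions) {ψ φ : ℝ → ℝ} (hψ : S.IsPsi ψ)
    (hφ : S.IsPhi ψ φ) :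
    ∫ t in (0 : ℝ)..S.T, φ t = ‖(hψ.memLp_mul_bu hS).toLp‖ ^ 2 := by
  have hT := hS.T_pos.le
  rw [integral_eq_of_adjoint (z₀ := 0) hT
    (intervalIntegrable_of_integrable_timeMeasure hT hS.integrable_by)
    (intervalIntegrable_bu_sq_mul hS hψ.1) hψ.1 hψ.2 hφ.1
    (fun t ht => by rw [zero_add]; exact hφ.2 t ht),
    ← real_inner_self_eq_norm_sq, L2.inner_def, mul_zero, zero_add,
    intervalIntegral.integral_of_le hT, ← integral_Icc_eq_integral_Ioc]
  refine integral_congr_ae ?_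
  filter_upwards [(hψ.memLp_mul_bu hS).coeFn_toLp] with t h1
  rw [h1, Real.inner_apply]
  ring

theorem exists_isPsi (hS : S.Assumptions) :
    ∃ ψ, S.IsPsi ψ ∧ ∀ t ∈ Set.Ico 0 S.T, 0 < ψ t := by
  obtain ⟨ψ, h1, h2, h3⟩ := exists_adjoint_solution hS.T_pos.le
    (intervalIntegrable_of_integrable_timeMeasure hS.T_pos.le hS.integrable_by)
  exact ⟨ψ, ⟨h1, h2⟩, h3⟩

theorem IsPsi.toLp_ne_zero (hS : S.Assumptions) {ψ : ℝ → ℝ} (hψ : S.IsPsi ψ)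
    (hpos : ∀ t ∈ Set.Ico 0 S.T, 0 < ψ t) (hbu : ¬ ∀ᵐ t ∂(timeMeasure S.T), S.bu' t = 0) :
    (hψ.memLp_mul_bu hS).toLp ≠ 0 := by
  intro h0
  refine hbu ?_
  have hne : ∀ᵐ t : ℝ ∂(timeMeasure S.T), t ≠ S.T := ae_restrict_of_ae (Measure.ae_ne volume S.T)
  have hc := (hψ.memLp_mul_bu hS).coeFn_toLp
  rw [h0] at hc
  filter_upwards [hc, Lp.coeFn_zero ℝ 2 (timeMeasure S.T), ae_restrict_mem measurableSet_Icc, hne]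
    with t hc hz h2 h3
  have h1 : ψ t * S.bu' t = 0 := hc.symm.trans hz
  exact (mul_eq_zero.1 h1).resolve_left (hpos t ⟨h2.1, lt_of_le_of_ne h2.2 h3⟩).ne'

theorem IsPsi.eqOn (hS : S.Assumptions) {ψ₁ ψ₂ : ℝ → ℝ} (h₁ : S.IsPsi ψ₁) (h₂ : S.IsPsi ψ₂) :
    Set.EqOn ψ₁ ψ₂ (Set.Icc 0 S.T) :=
  adjoint_solution_unique hS.T_pos.le
    (intervalIntegrable_of_integrable_timeMeasure hS.T_pos.le hS.integrable_by) h₁.1 h₂.1 h₁.2 h₂.2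

/-- Lets solutions `φ` built from different `ψ` be compared, as uniqueness of the pair requires. -/
theorem IsPhi.congr {ψ₁ ψ₂ φ : ℝ → ℝ} (h : S.IsPhi ψ₁ φ) (he : Set.EqOn ψ₁ ψ₂ (Set.Icc 0 S.T)) :
    S.IsPhi ψ₂ φ := by
  refine ⟨h.1, fun t ht => (h.2 t ht).trans (intervalIntegral.integral_congr fun s hs => ?_)⟩
  rw [Set.uIcc_of_le ht.1] at hs
  simp only [he ⟨hs.1, hs.2.trans ht.2⟩]

theorem IsPhi.eqOn (hS : S.Assumptions) {ψ φ₁ φ₂ : ℝ → ℝ} (hψ : S.IsPsi ψ) (h₁ : S.IsPhi ψ φ₁)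
    (h₂ : S.IsPhi ψ φ₂) : Set.EqOn φ₁ φ₂ (Set.Icc 0 S.T) :=
  linear_ode_solution_unique hS.T_pos.le
    (intervalIntegrable_of_integrable_timeMeasure hS.T_pos.le hS.integrable_by)
    (intervalIntegrable_bu_sq_mul hS hψ.1) h₁.1 h₂.1 h₁.2 h₂.2

theorem exists_isPhi (hS : S.Assumptions) {ψ : ℝ → ℝ} (hψ : S.IsPsi ψ) : ∃ φ, S.IsPhi ψ φ := by
  obtain ⟨φ, h1, h2⟩ := exists_linear_ode_solution
    (intervalIntegrable_of_integrable_timeMeasure hS.T_pos.le hS.integrable_by)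
    (intervalIntegrable_bu_sq_mul hS hψ.1)
  rw [Set.uIcc_of_le hS.T_pos.le] at h1 h2
  exact ⟨φ, h1, h2⟩

end LinearSOCP

/-! ### Projection onto a half-space and the conclusion -/

theorem halfSpace_projection {E : Type*} [NormedAddCommGroup E] [InnerProductSpace ℝ E]
    {G : E → ℝ} {g : E} (hg : g ≠ 0) (hG : ∀ v w, G v - G w = inner ℝ g (v - w)) (w p : E)
    (hp : p = w - (max (G w) 0 / ‖g‖ ^ 2) • g) :
    G p ≤ 0 ∧ (∀ v, G v ≤ 0 → 0 ≤ inner ℝ (p - w) (v - p)) ∧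
      ∀ q, IsProjection {v | G v ≤ 0} w q ↔ q = p := by
  have hg2 : 0 < ‖g‖ ^ 2 := by positivity
  set κ := max (G w) 0 / ‖g‖ ^ 2 with hκ
  have hκg : κ * ‖g‖ ^ 2 = max (G w) 0 := div_mul_cancel₀ _ hg2.ne'
  have hpw : p - w = -(κ • g) := by rw [hp]; abel
  have hGp : G p = G w - max (G w) 0 := by
    have h := hG p w
    rw [hpw, inner_neg_right, inner_smul_right, real_inner_self_eq_norm_sq, hκg] at h
    linarith
  have h1 : G p ≤ 0 := by linarith [le_max_left (G w) 0]
  have h2 : ∀ v, G v ≤ 0 → 0 ≤ inner ℝ (p - w) (v - p) := by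
    intro v hv
    rw [hpw, inner_neg_left, real_inner_smul_left, ← hG]
    -- If `G w ≤ 0` then `κ = 0` and `p = w`. Otherwise `G p = 0`, so the product is `-κ (G v - G p)
    -- = -κ G v ≥ 0`.
    rcases le_total (G w) 0 with h | h
    · rw [max_eq_right h, zero_div] at hκ
      rw [hκ]; simp
    · rw [max_eq_left h, sub_self] at hGp
      have : 0 ≤ κ := by positivity
      nlinarith
  -- This Pythagorean inequality gives both minimality of `p` and, through the extra term,
  -- uniqueness.
  have h3 : ∀ v, G v ≤ 0 → ‖w - p‖ ^ 2 + ‖p - v‖ ^ 2 ≤ ‖w - v‖ ^ 2 := by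
    intro v hv
    have := h2 v hv
    rw [← sub_add_sub_cancel w p v, norm_add_sq_real, ← neg_sub p w, ← neg_sub v p, inner_neg_neg]
    linarith
  refine ⟨h1, h2, fun q => ⟨fun hq => ?_, fun hq => ?_⟩⟩
  · have h4 := h3 q hq.1
    have h5 := pow_le_pow_left₀ (norm_nonneg _) (hq.2 p h1) 2
    have h6 : ‖p - q‖ ^ 2 ≤ 0 := by linarith
    have h7 : ‖p - q‖ = 0 := pow_eq_zero_iff two_ne_zero |>.1 (le_antisymm h6 (sq_nonneg _))
    exact (sub_eq_zero.1 (norm_eq_zero.1 h7)).symm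
  · subst hq
    refine ⟨h1, fun z hz => ?_⟩
    have h4 := h3 z hz
    exact (pow_le_pow_iff_left₀ (norm_nonneg _) (norm_nonneg _) two_ne_zero).1
      (by linarith [sq_nonneg ‖q - z‖])

theorem mainTheorem2 {Ω : Type*} {mΩ : MeasurableSpace Ω} (P : Measure Ω)
    [IsProbabilityMeasure P] (𝓕 : Filtration ℝ≥0 mΩ) (W : ℝ≥0 → Ω → ℝ)
    (hW : IsBrownianMotionFor P 𝓕 W) (S : LinearSOCP) (hS : S.Assumptions)
    (hbu : ¬ ∀ᵐ t ∂(timeMeasure S.T), S.bu' t = 0) (ρ : ℝ) (hρ : 0 < ρ) :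
    (∀ u : Control S.T, S.IsState P 𝓕 W u (S.state P 𝓕 W u)) ∧
    ∃ ψ φ : ℝ → ℝ, S.IsPsi ψ ∧ S.IsPhi ψ φ ∧
      (∀ ψ₁ φ₁ : ℝ → ℝ, S.IsPsi ψ₁ → S.IsPhi ψ₁ φ₁ →
        Set.EqOn ψ₁ ψ (Set.Icc 0 S.T) ∧ Set.EqOn φ₁ φ (Set.Icc 0 S.T)) ∧
      0 < (∫ t in (0 : ℝ)..S.T, φ t) ∧
      (∀ w : Control S.T,
        0 ≤ S.multiplier P 𝓕 W ρ φ w ∧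
        ∃ p : Control S.T,
          (∀ᵐ t ∂(timeMeasure S.T),
            p t = w t - ρ * S.multiplier P 𝓕 W ρ φ w * ψ t * S.bu' t) ∧
          p ∈ S.feasible P 𝓕 W ∧
          (∀ v ∈ S.feasible P 𝓕 W, 0 ≤ inner ℝ (p - w) (v - p)) ∧
          ∀ q : Control S.T, IsProjection (S.feasible P 𝓕 W) w q ↔ q = p) ∧
      (∀ (u : ℕ → Control S.T) (i : ℕ),
        DifferentiableAt ℝ (S.J P 𝓕 W) (u i) →
        IsProjection (S.feasible P 𝓕 W) (S.gradStep P 𝓕 W ρ (u i)) (u (i + 1)) →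
          0 ≤ S.multiplier P 𝓕 W ρ φ (S.gradStep P 𝓕 W ρ (u i)) ∧
          (∀ᵐ t ∂(timeMeasure S.T),
            u (i + 1) t = S.gradStep P 𝓕 W ρ (u i) t
              - ρ * S.multiplier P 𝓕 W ρ φ (S.gradStep P 𝓕 W ρ (u i)) * ψ t * S.bu' t) ∧
          S.expectedIntegral P 𝓕 W (u (i + 1)) ≤ S.δ ∧
          (∀ v ∈ S.feasible P 𝓕 W,
            0 ≤ inner ℝ (u (i + 1) - S.gradStep P 𝓕 W ρ (u i)) (v - u (i + 1)))) := by
  have hstate := LinearSOCP.isState_state (𝓕 := 𝓕) hS hW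
  obtain ⟨ψ, hψ, hpos⟩ := LinearSOCP.exists_isPsi hS
  obtain ⟨φ, hφ⟩ := LinearSOCP.exists_isPhi hS hψ
  have hg := hψ.toLp_ne_zero hS hpos hbu
  have hint := hφ.integral_eq hS hψ
  have hφpos : 0 < ∫ t in (0 : ℝ)..S.T, φ t := by
    rw [hint]
    positivity
  have hproj : ∀ w : Control S.T,
      0 ≤ S.multiplier P 𝓕 W ρ φ w ∧
      ∃ p : Control S.T,
        (∀ᵐ t ∂(timeMeasure S.T),
          p t = w t - ρ * S.multiplier P 𝓕 W ρ φ w * ψ t * S.bu' t) ∧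
        p ∈ S.feasible P 𝓕 W ∧
        (∀ v ∈ S.feasible P 𝓕 W, 0 ≤ inner ℝ (p - w) (v - p)) ∧
        ∀ q : Control S.T, IsProjection (S.feasible P 𝓕 W) w q ↔ q = p := by
    intro w
    refine ⟨div_nonneg (le_max_right _ _) (mul_pos hρ hφpos).le, _, ?_,
      halfSpace_projection hg (LinearSOCP.G_sub_eq_inner hS hW hψ) w _ rfl⟩
    -- The `ρ` in the denominator of the multiplier cancels, and `∫ φ = ‖ψ b_u'‖²` leaves the
    -- half-space coefficient.
    have hmul : ρ * S.multiplier P 𝓕 W ρ φ w =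
        max (S.G P 𝓕 W w) 0 / ‖(hψ.memLp_mul_bu hS).toLp‖ ^ 2 := by
      rw [LinearSOCP.multiplier, LinearSOCP.expectedIntegral_eq hS hW, add_sub_cancel_right, hint]
      field_simp
    rw [hmul]
    filter_upwards [Lp.coeFn_sub w ((max (S.G P 𝓕 W w) 0 / ‖(hψ.memLp_mul_bu hS).toLp‖ ^ 2) •
        (hψ.memLp_mul_bu hS).toLp), Lp.coeFn_smul (max (S.G P 𝓕 W w) 0 /
        ‖(hψ.memLp_mul_bu hS).toLp‖ ^ 2) (hψ.memLp_mul_bu hS).toLp,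
      (hψ.memLp_mul_bu hS).coeFn_toLp] with t h1 h2 h3
    rw [h1, Pi.sub_apply, h2, Pi.smul_apply, h3, smul_eq_mul]
    ring
  refine ⟨hstate, ψ, φ, hψ, hφ, fun ψ₁ φ₁ h₁ h₂ => ?_, hφpos, hproj, fun u i _ hu => ?_⟩
  · have he := h₁.eqOn hS hψ
    exact ⟨he, (h₂.congr he).eqOn hS hψ hφ⟩
  · obtain ⟨h0, p, hp, hpf, hpv, hpu⟩ := hproj (S.gradStep P 𝓕 W ρ (u i))
    rw [(hpu _).1 hu]
    refine ⟨h0, hp, ?_, hpv⟩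
    rw [LinearSOCP.expectedIntegral_eq hS hW]
    have : S.G P 𝓕 W p ≤ 0 := hpf
    linarith
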